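/- Let $q = 2^{2e+1}$ with $e \ge 1$, and let $U$ be a Buekenhout-Tits unital in $\mathrm{PG}(2,q^2)$ with line at infinity $\ell_\infty$. That is, in the André/Bruck-Bose representation of $\mathrm{PG}(2,q^2)$ with respect to $\ell_\infty$ (where $\mathrm{PG}(2,q^2)\setminus\ell_\infty$ is identified with $\mathrm{PG}(4,q)\setminus\Sigma$ for a hyperplane $\Sigma$, and the points of $\ell_\infty$ with the lines of a Desarguesian spread of $\Sigma$), $U$ corresponds to an ovoidal cone $\mathcal{C}$ of $\mathrm{PG}(4,q)$ whose base is a Tits ovoid, lying in a solid not containing the vertex of $\mathcal C$, and such that $\mathcal{C} \cap \Sigma$ is a line of the spread. Here a Tits ovoid is a set of points of $\mathrm{PG}(3,q)$ projectively equivalent to $\{(0,0,0,1)\} \cup \{(1,s,t,s^{\sigma+2}+t^{\sigma}+st) \mid s,t\in\mathbb{F}_q\}$, where $\sigma = 2^{e+1}$. For a point $P \notin U$, the feet $\tau_P(U)$ of $P$ are the points $Q \in U$ such that some line through $P$ meets $U$ in $Q$ only. Then for every point $P \notin \ell_\infty \cup U$ and every line $\ell$ we have $|\ell \cap \tau_P(U)|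 \le 4$. Moreover, for each $k \in \{0,1,2,3,4\}$ there are a point $P \notin \ell_\infty \cup U$ and a line $\ell$ with $|\ell \cap \tau_P(U)| = k$. In particular, it is not the case that for all points $P \notin \ell_\infty\cup U$ every line meets $\tau_P(U)$ in $0$, $1$, $2$ or $4$ points. -/

import Mathlib

open scoped LinearAlgebra.Projectivization

namespace BTUnital

section Geometry

variable {k V : Type*} [Field k] [AddCommGroup V] [Module k V]

/-- The set of points of the projective space of `V` lying in the projective subspace
given by the vector subspace `W`. -/
def subspacePoints (W : Submodule k V) : Set (ℙ k V) := {P | P.submodule ≤ W}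

/-- A set of points is a line if it consists of the points of a two-dimensional
vector subspace. -/
def IsLine (l : Set (ℙ k V)) : Prop :=
  ∃ W : Submodule k V, Module.finrank k W = 2 ∧ l = subspacePoints W

/-- The feet of `P` with respect to `U`: the points `Q` of `U` such that some line through `P`
is tangent to `U` at `Q`, that is, meets `U` in `Q` only. -/
def feet (U : Set (ℙ k V)) (P : ℙ k V) : Set (ℙ k V) :=
  {Q | ∃ l : Set (ℙ k V), IsLine l ∧ P ∈ l ∧ l ∩ U = {Q}}

/-- The cone with vertex `N` and base `O`: the union of the lines joining `N` to the
points of `O`. -/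
def coneOver (N : ℙ k V) (O : Set (ℙ k V)) : Set (ℙ k V) :=
  ⋃ Q ∈ O, subspacePoints (N.submodule ⊔ Q.submodule)

end Geometry

section TitsOvoid

variable {F : Type*} [Field F]

theorem affinePoint_ne_zero (s t r : F) : ![1, s, t, r] ≠ (0 : Fin 4 → F) := fun h =>
  one_ne_zero (congrFun h 0)

theorem pointAtInfinity_ne_zero : ![0, 0, 0, 1] ≠ (0 : Fin 4 → F) := fun h =>
  one_ne_zero (congrFun h 3)

/-- The standard Tits ovoid of `PG(3, q)`, `q = 2 ^ (2 * e + 1)`, with `σ = 2 ^ (e + 1)`. -/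
def standardTitsOvoid (F : Type*) [Field F] (e : ℕ) : Set (ℙ F (Fin 4 → F)) :=
  {Projectivization.mk F ![0, 0, 0, 1] pointAtInfinity_ne_zero} ∪
    {P | ∃ s t : F, P = Projectivization.mk F
      ![1, s, t, s ^ (2 ^ (e + 1) + 2) + t ^ (2 ^ (e + 1)) + s * t]
      (affinePoint_ne_zero _ _ _)}

variable {M : Type*} [AddCommGroup M] [Module F M]

/-- `O` is a Tits ovoid in the solid (three-dimensional projective subspace) `H`:
the image of the standard Tits ovoid under a projectivity from `PG(3, q)` onto `H`. -/
def IsTitsOvoidIn (e : ℕ) (H : Submodule F M) (O : Set (ℙ F M)) : Prop :=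
  ∃ (φ : (Fin 4 → F) →ₗ[F] M) (hφ : Function.Injective φ),
    LinearMap.range φ = H ∧ O = Projectivization.map φ hφ '' standardTitsOvoid F e

/-- `C` is an ovoidal cone whose base is a Tits ovoid, lying in a solid that does not contain
the vertex. -/
def IsTitsCone (e : ℕ) (C : Set (ℙ F M)) : Prop :=
  ∃ (H : Submodule F M) (O : Set (ℙ F M)) (N : ℙ F M),
    IsTitsOvoidIn e H O ∧ N ∉ subspacePoints H ∧ C = coneOver N O

end TitsOvoid

section ABB

/-! The André/Bruck-Bose representation of `PG(2, q ^ 2)` in `PG(4, q)`. The five-dimensional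
vector space over `F` underlying `PG(4, q)` is `F × (K × K)`, where `K` has degree two over `F`. -/

variable (F K : Type*) [Field F] [Field K] [Algebra F K]

/-- The hyperplane at infinity of `PG(4, q)`: the first coordinate vanishes. -/
def hyperplaneAtInfinity : Submodule F (F × (K × K)) :=
  LinearMap.ker (LinearMap.fst F F (K × K))

variable {K} in
/-- For `w ≠ 0`, the element `{(0, c • w) | c ∈ K}` of the Desarguesian line spread of the
hyperplane at infinity: a two-dimensional subspace over `F`. -/
def spreadElement (w : K × K) : Submodule F (F × (K × K)) :=
  LinearMap.range ((LinearMap.inr F F (K × K)).comp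
    ((LinearMap.toSpanSingleton K (K × K) w).restrictScalars F))

/-- The semilinear map `(x, y, z) ↦ (x, y, z)` from `F × (K × K)` to `K ^ 3`. -/
def abbMap : (F × (K × K)) →ₛₗ[algebraMap F K] (Fin 3 → K) where
  toFun p := ![algebraMap F K p.1, p.2.1, p.2.2]
  map_add' p q := by
    ext i; fin_cases i <;> simp
  map_smul' a p := by
    ext i; fin_cases i <;> simp [Algebra.smul_def]

theorem abbMap_injective : Function.Injective (abbMap F K) := by
  rintro ⟨a, b, c⟩ ⟨a', b', c'⟩ h
  have h0 : algebraMap F K a = algebraMap F K a' := congrFun h 0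
  have h1 : b = b' := congrFun h 1
  have h2 : c = c' := congrFun h 2
  rw [(algebraMap F K).injective h0, h1, h2]

/-- The André/Bruck-Bose correspondence on points. It is a bijection from the points off the
hyperplane at infinity to the points off the line `x = 0`, and it sends all points of
a spread element `{0} × K w` to the point `(0, w)` of the line `x = 0`. -/
def abbPoint : ℙ F (F × (K × K)) → ℙ K (Fin 3 → K) :=
  Projectivization.map (abbMap F K) (abbMap_injective F K)

/-- The vector subspace of `K ^ 3` defining the line `x = 0` of `PG(2, q ^ 2)`. -/
def lineXZero : Submodule K (Fin 3 → K) :=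
  LinearMap.ker (LinearMap.proj (R := K) (φ := fun _ : Fin 3 => K) 0)

variable {K} in
/-- `U` is a Buekenhout-Tits unital in `PG(2, q ^ 2)` with line at infinity `linf`: for some
choice of homogeneous coordinates (given by `g`) in which `linf` is the line `x = 0`, the set `U`
corresponds in the André/Bruck-Bose representation to an ovoidal cone over a Tits ovoid
meeting the hyperplane at infinity exactly in an element of the Desarguesian spread. -/
def IsBuekenhoutTitsUnital (e : ℕ) (linf U : Set (ℙ K (Fin 3 → K))) : Prop :=
  ∃ (g : (Fin 3 → K) ≃ₗ[K] (Fin 3 → K)) (C : Set (ℙ F (F × (K × K)))),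
    IsTitsCone e C ∧
    (∃ w : K × K, w ≠ 0 ∧
      C ∩ subspacePoints (hyperplaneAtInfinity F K) = subspacePoints (spreadElement F w)) ∧
    linf = Projectivization.map g.toLinearMap g.injective '' subspacePoints (lineXZero K) ∧
    U = Projectivization.map g.toLinearMap g.injective '' (abbPoint F K '' C)

end ABB

end BTUnital

/-! Write f for `titsForm σ`, where σ² is squaring. In suitable coordinates U consists of (0,0,1)
and the points (1, s + tε, r + f(s,t)ε), with ε in K outside F and ε² = Tε + D. A given P off ℓ∞ ∪ U
can be taken to be (1,1,0), at the cost of an ε that depends on P (`exists_std_of_point`). A line z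
= m(y + 1) through P meets U in the points over a plane section of the Tits ovoid, and this section
is a single point exactly when the plane is tangent. Hence the feet are the points (1, y, ȳ(y + 1)),
y = s + tε, with (s,t) on the oval f(s,t) = t (`feet_stdUnital`).

On the line a + by + z = 0 the feet satisfy a + by + ȳ(y + 1) = 0, whose ε-component is linear in
(s,t). If b ≠ 1 it is a genuine linear equation, and a line meets an ellipse in at most two points.
If b = 1 then a lies in F and the equation is N(y + 1) = a + 1, an ellipse with the same nucleus
(1,0) as the oval. Parametrising the oval by the lines through that nucleus gives aθ² + Tθ + (a +
1)σ(θ) + D + a + 1 = 0. Eliminating σ(θ) leaves a quartic if a ≠ 0; if a = 0 it leaves a quadratic,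
and the extra point (0,0) counts too. So four is the maximum (`ncard_footParams_le_four`).

For the exact values, any prescribed ε outside F occurs for the given U at some P
(`exists_std_of_slope`). With T = D = 1 and a = 0 the equation is σ(θ) = θ, so θ is 0 or 1, and
(0,0) makes three feet. For four, T = 1, and a and D are chosen so that the solutions include a
coset of {0, 1, b, b + 1}; a trace argument keeps X² + X + D irreducible (`exists_ellipse_four`).
The values 0, 1, 2 come from ℓ∞, the line y = 0, and a line of slope b ≠ 1 through two feet. -/

namespace BTUnital

/-! ### The Tits form: identities and tangent planes. -/

section TitsForm

variable {F : Type*} [Field F] {σ : F ≃+* F}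

/-- The form `s ^ (σ + 2) + t ^ σ + s t` defining the affine part of the Tits ovoid. -/
def titsForm (σ : F ≃+* F) (s t : F) : F := σ s * s ^ 2 + σ t + s * t

theorem symm_sq_eq (hσ : ∀ x, σ (σ x) = x ^ 2) (x : F) : σ.symm x ^ 2 = σ x := by
  rw [← hσ, RingEquiv.apply_symm_apply]

theorem titsForm_diag (hσ : ∀ x, σ (σ x) = x ^ 2) (l x y : F) :
    titsForm σ (l * x) (l * σ l * y) = l ^ 2 * σ l * titsForm σ x y := by
  simp only [titsForm, map_mul, hσ]
  ring

/-- Treating σ as an exponent with σ² = 2, one has (σ + 2)(1 − 1/σ) = 1, which gives the root c /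
σ⁻¹(c). -/
theorem exists_pow_sigma_add_two (hσ : ∀ x, σ (σ x) = x ^ 2) {c : F} (hc : c ≠ 0) :
    ∃ p : F, p ≠ 0 ∧ σ p * p ^ 2 = c := by
  have h0 : σ.symm c ≠ 0 := by simpa using hc
  refine ⟨c / σ.symm c, div_ne_zero hc h0, ?_⟩
  have h1 : σ c ≠ 0 := by simpa using hc
  rw [map_div₀, RingEquiv.apply_symm_apply, div_pow, symm_sq_eq hσ]
  field_simp

variable [CharP F 2]

theorem titsForm_eq_zero_iff (hσ : ∀ x, σ (σ x) = x ^ 2) {s t : F} :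
    titsForm σ s t = 0 ↔ s = 0 ∧ t = 0 := by
  refine ⟨fun h => ?_, by rintro ⟨rfl, rfl⟩; simp [titsForm]⟩
  unfold titsForm at h
  have h1 : σ (σ s * s ^ 2 + σ t + s * t) = 0 := by rw [h, map_zero]
  simp only [map_add, map_mul, map_pow, hσ] at h1
  have ht : t = 0 ∨ t = σ s * s := by
    -- Eliminating σ t between f = 0 and its image under σ leaves a factorised equation.
    have : t * (t + σ s * s) = 0 := by grind
    rcases mul_eq_zero.1 this with h | h
    · exact .inl h
    · exact .inr (by grind)
  have hs : s = 0 := by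
    rcases ht with rfl | rfl
    · have h2 : σ s * s ^ 2 = 0 := by simpa using h
      simpa using h2
    · have h2 : σ s * s ^ 2 = 0 := by
        simp only [map_mul, hσ] at h
        grind
      simpa using h2
  subst hs
  refine ⟨rfl, ?_⟩
  simpa using h

/-- The error terms are affine in x and y, so this substitution is a collineation of the ovoid. It
moves any affine point to the origin, where the tangent plane is f = 0. -/
theorem titsForm_translate (hσ : ∀ x, σ (σ x) = x ^ 2) (a b x y : F) :
    titsForm σ (x + a) (y + b + σ a * x) =
      titsForm σ x y + (b + σ a * a) * x + a * y + titsForm σ a b := by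
  simp only [titsForm, map_add, map_mul, hσ]
  grind

theorem titsForm_swap (hσ : ∀ x, σ (σ x) = x ^ 2) {x y : F} (h : titsForm σ x y ≠ 0) :
    titsForm σ (y / titsForm σ x y) (x / titsForm σ x y) = 1 / titsForm σ x y := by
  have hz : σ (titsForm σ x y) = x ^ 2 * σ x ^ 2 + y ^ 2 + σ x * σ y := by
    simp only [titsForm, map_add, map_mul, map_pow, hσ]
  have hz0 : σ (titsForm σ x y) ≠ 0 := by simpa using h
  have key : σ y * y ^ 2 + σ x * titsForm σ x y ^ 2
      + x * y * σ (titsForm σ x y) = titsForm σ x y * σ (titsForm σ x y) := by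
    rw [hz]; simp only [titsForm]; grind
  generalize titsForm σ x y = z at *
  simp only [titsForm, map_div₀]
  field_simp
  linear_combination key

/-- The tangent plane of the Tits ovoid at an affine point meets it in that point only. -/
theorem eq_of_titsForm_tangent (hσ : ∀ x, σ (σ x) = x ^ 2) {s t s' t' : F}
    (h : titsForm σ s' t' = t * s' + s * t' + titsForm σ s t) : s' = s ∧ t' = t := by
  have key := titsForm_translate hσ s t (s' + s) (t' + t + σ s * (s' + s))
  have e1 : s' + s + s = s' := by grind
  have e2 : t' + t + σ s * (s' + s) + t + σ s * (s' + s) = t' := by grind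
  rw [e1, e2, h] at key
  have : titsForm σ (s' + s) (t' + t + σ s * (s' + s)) = 0 := by grind
  obtain ⟨h1, h2⟩ := (titsForm_eq_zero_iff hσ).1 this
  rw [h1] at h2
  exact ⟨by grind, by grind⟩

/-- A plane through the origin of the ovoid, other than the tangent plane there and not through
(0,0,0,1), has a second affine point on the ovoid. -/
theorem exists_titsForm_eq_linear (hσ : ∀ x, σ (σ x) = x ^ 2) {α β : F} (h : α ≠ 0 ∨ β ≠ 0) :
    ∃ x y : F, (x ≠ 0 ∨ y ≠ 0) ∧ titsForm σ x y = α * x + β * y := by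
  by_cases hβ : β = 0
  · have hα : α ≠ 0 := by simpa [hβ] using h
    obtain ⟨p, hp, h⟩ := exists_pow_sigma_add_two hσ (c := σ α) (by simpa using hα)
    refine ⟨p, α, .inl hp, ?_⟩
    rw [titsForm, h, hβ]; grind
  · refine ⟨0, β * σ β, .inr (by simpa using hβ), ?_⟩
    simp only [titsForm, map_mul, hσ, map_zero]; ring

/-- A plane section of the Tits ovoid that is a single affine point is cut out by the tangent
plane at that point. -/
theorem tangent_of_forall_eq (hσ : ∀ x, σ (σ x) = x ^ 2) {s t α β γ : F}
    (h : titsForm σ s t = α * s + β * t + γ)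
    (hu : ∀ s' t', titsForm σ s' t' = α * s' + β * t' + γ → s' = s ∧ t' = t) :
    α = t ∧ β = s := by
  by_contra hc
  -- These are the coefficients of the plane after (s, t) is translated to the origin.
  have : α + t + σ s * (β + s) ≠ 0 ∨ β + s ≠ 0 := by
    by_contra hcc
    push Not at hcc
    obtain ⟨h1, h2⟩ := hcc
    rw [h2] at h1
    exact hc ⟨by grind, by grind⟩
  obtain ⟨x, y, hxy, e⟩ := exists_titsForm_eq_linear hσ this
  have key := titsForm_translate hσ s t x y
  obtain ⟨h1, h2⟩ := hu (x + s) (y + t + σ s * x) (by rw [key, e, h]; grind)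
  have hx : x = 0 := by grind
  have hy : y = 0 := by rw [hx] at h2; grind
  simp [hx, hy] at hxy

/-! ### The oval f(s,t) = t and its intersections with ellipses. -/

/-- The second coordinates of the points of the oval `f(s, t) = t` are the inverses of the
values of `θ ^ (1 / σ) + θ + 1`. -/
def ovalDenom (σ : F ≃+* F) (θ : F) : F := σ.symm θ + θ + 1

theorem eq_zero_or_one_of_sigma_eq (hσ : ∀ x, σ (σ x) = x ^ 2) {x : F} (h : σ x = x) :
    x = 0 ∨ x = 1 := by
  have h1 := hσ x
  rw [h, h] at h1
  have : x * (x + 1) = 0 := by grind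
  rcases mul_eq_zero.1 this with h | h
  · exact .inl h
  · exact .inr (by grind)

theorem sigma_ne_add_one (hσ : ∀ x, σ (σ x) = x ^ 2) (x : F) : σ x ≠ x + 1 := fun h => by
  have h1 := hσ x
  rw [h, map_add, h, map_one] at h1
  have : x * (x + 1) = 0 := by grind
  rcases mul_eq_zero.1 this with h2 | h2
  · simp [h2] at h
  · have : x = 1 := by grind
    simp [this] at h

theorem ovalDenom_ne_zero (hσ : ∀ x, σ (σ x) = x ^ 2) (θ : F) : ovalDenom σ θ ≠ 0 := fun h => by
  apply sigma_ne_add_one hσ (σ.symm θ)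
  unfold ovalDenom at h
  rw [RingEquiv.apply_symm_apply]; grind

theorem titsForm_oval (hσ : ∀ x, σ (σ x) = x ^ 2) (θ : F) :
    titsForm σ (1 + θ / ovalDenom σ θ) (1 / ovalDenom σ θ) = 1 / ovalDenom σ θ := by
  have h0 := ovalDenom_ne_zero hσ θ
  have h1 : σ (ovalDenom σ θ) ≠ 0 := by simpa using h0
  have e1 : σ (ovalDenom σ θ) = θ + σ θ + 1 := by
    simp [ovalDenom]
  have e2 : ovalDenom σ θ ^ 2 = σ θ + θ ^ 2 + 1 := by
    rw [← symm_sq_eq hσ, ovalDenom]; grind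
  generalize ovalDenom σ θ = τ at *
  simp only [titsForm, map_add, map_one, map_div₀]
  field_simp
  grind

theorem oval_cases (hσ : ∀ x, σ (σ x) = x ^ 2) {s t : F} (h : titsForm σ s t = t) :
    (s = 0 ∧ t = 0) ∨ ∃ θ, s = 1 + θ / ovalDenom σ θ ∧ t = 1 / ovalDenom σ θ := by
  by_cases ht : t = 0
  · left
    exact (titsForm_eq_zero_iff hσ).1 (h.trans ht)
  · right
    refine ⟨(s + 1) / t, ?_⟩
    set θ := (s + 1) / t with hθ
    have h2 := titsForm_oval hσ θ
    have hs : s = 1 + θ * t := by rw [hθ]; field_simp; grind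
    -- The line s + 1 = θt through the nucleus (1,0) is tangent to the oval at the point with
    -- parameter θ, so (s, t), lying on both, is that point.
    refine eq_of_titsForm_tangent hσ ?_
    rw [h, h2]
    have h0 := ovalDenom_ne_zero hσ θ
    rw [hs]
    field_simp
    grind

theorem sq_ovalDenom (hσ : ∀ x, σ (σ x) = x ^ 2) (θ : F) :
    ovalDenom σ θ ^ 2 = σ θ + θ ^ 2 + 1 := by
  rw [← symm_sq_eq hσ, ovalDenom]; grind

/-- Intersection of the oval `f(s, t) = t` with an ellipse having the same nucleus. -/
theorem oval_mem_ellipse_iff (hσ : ∀ x, σ (σ x) = x ^ 2) (T D a θ : F) :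
    (1 + θ / ovalDenom σ θ) ^ 2 + T * (1 + θ / ovalDenom σ θ) * (1 / ovalDenom σ θ)
        + D * (1 / ovalDenom σ θ) ^ 2 + T * (1 / ovalDenom σ θ) + a = 0 ↔
      a * θ ^ 2 + T * θ + (a + 1) * σ θ + (D + a + 1) = 0 := by
  have h0 := ovalDenom_ne_zero hσ θ
  have e2 := sq_ovalDenom hσ θ
  have : (1 + θ / ovalDenom σ θ) ^ 2 + T * (1 + θ / ovalDenom σ θ) * (1 / ovalDenom σ θ)
        + D * (1 / ovalDenom σ θ) ^ 2 + T * (1 / ovalDenom σ θ) + a =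
      (a * θ ^ 2 + T * θ + (a + 1) * σ θ + (D + a + 1)) / ovalDenom σ θ ^ 2 := by
    generalize ovalDenom σ θ = τ at *
    field_simp
    grind
  rw [this, div_eq_zero_iff]
  simp [h0]

open Polynomial in
theorem ncard_quartic_le {R : Type*} [Field R] {a4 : R} (a3 a2 a1 a0 : R) (h : a4 ≠ 0) :
    {x : R | a4 * x ^ 4 + a3 * x ^ 3 + a2 * x ^ 2 + a1 * x + a0 = 0}.Finite ∧
    {x : R | a4 * x ^ 4 + a3 * x ^ 3 + a2 * x ^ 2 + a1 * x + a0 = 0}.ncard ≤ 4 := by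
  classical
  set p : R[X] := C a4 * X ^ 4 + C a3 * X ^ 3 + C a2 * X ^ 2 + C a1 * X + C a0 with hp
  have hd : p.natDegree ≤ 4 := by rw [hp]; compute_degree
  have h4 : p.coeff 4 = a4 := by simp [hp]
  have hp0 : p ≠ 0 := fun h0 => h (by rw [← h4, h0, coeff_zero])
  have hs : {x : R | a4 * x ^ 4 + a3 * x ^ 3 + a2 * x ^ 2 + a1 * x + a0 = 0}
      = (p.roots.toFinset : Set R) := by
    ext x
    rw [Finset.mem_coe, Multiset.mem_toFinset, mem_roots hp0]
    simp [hp]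
  rw [hs, Set.ncard_coe_finset]
  exact ⟨Finset.finite_toSet _,
    (Multiset.toFinset_card_le _).trans ((card_roots' p).trans hd)⟩

open Polynomial in
theorem ncard_quadratic_le {R : Type*} [Field R] {a2 : R} (a1 a0 : R) (h : a2 ≠ 0) :
    {x : R | a2 * x ^ 2 + a1 * x + a0 = 0}.Finite ∧
    {x : R | a2 * x ^ 2 + a1 * x + a0 = 0}.ncard ≤ 2 := by
  classical
  set p : R[X] := C a2 * X ^ 2 + C a1 * X + C a0 with hp
  have hd : p.natDegree ≤ 2 := by rw [hp]; compute_degree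
  have h4 : p.coeff 2 = a2 := by simp [hp]
  have hp0 : p ≠ 0 := fun h0 => h (by rw [← h4, h0, coeff_zero])
  have hs : {x : R | a2 * x ^ 2 + a1 * x + a0 = 0} = (p.roots.toFinset : Set R) := by
    ext x
    rw [Finset.mem_coe, Multiset.mem_toFinset, mem_roots hp0]
    simp [hp]
  rw [hs, Set.ncard_coe_finset]
  exact ⟨Finset.finite_toSet _,
    (Multiset.toFinset_card_le _).trans ((card_roots' p).trans hd)⟩

/-- Apply σ to the equation, multiply by (a + 1)², and replace (a + 1)σ(θ) by its quadratic
expression in θ. The resulting quartic has leading coefficient σ(a)a², and no cubic term since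
squaring is additive. -/
theorem ncard_ellipse_param_le (hσ : ∀ x, σ (σ x) = x ^ 2) (T D : F) {a : F} (ha : a ≠ 0) :
    {θ : F | a * θ ^ 2 + T * θ + (a + 1) * σ θ + (D + a + 1) = 0}.Finite ∧
    {θ : F | a * θ ^ 2 + T * θ + (a + 1) * σ θ + (D + a + 1) = 0}.ncard ≤ 4 := by
  have hsa : σ a ≠ 0 := by simpa using ha
  obtain ⟨hf, hc⟩ := ncard_quartic_le (a4 := σ a * a ^ 2) 0
    (σ a * T ^ 2 + (a + 1) * σ T * a + (a + 1) ^ 2 * (σ a + 1)) ((a + 1) * σ T * T)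
    (σ a * (D + a + 1) ^ 2 + (a + 1) * σ T * (D + a + 1) + (a + 1) ^ 2 * (σ D + σ a + 1))
    (by simp [ha])
  have hsub : {θ : F | a * θ ^ 2 + T * θ + (a + 1) * σ θ + (D + a + 1) = 0} ⊆
    {x : F | (σ a * a ^ 2) * x ^ 4 + 0 * x ^ 3 +
      (σ a * T ^ 2 + (a + 1) * σ T * a + (a + 1) ^ 2 * (σ a + 1)) * x ^ 2
      + ((a + 1) * σ T * T) * x + (σ a * (D + a + 1) ^ 2 + (a + 1) * σ T * (D + a + 1)
        + (a + 1) ^ 2 * (σ D + σ a + 1)) = 0} := by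
    intro x hx
    rw [Set.mem_ofPred_eq] at hx ⊢
    have hx' : σ (a * x ^ 2 + T * x + (a + 1) * σ x + (D + a + 1)) = 0 := by rw [hx, map_zero]
    simp only [map_add, map_mul, map_pow, hσ, map_one] at hx'
    have hk : (a + 1) * σ x = a * x ^ 2 + T * x + (D + a + 1) := by grind
    have h2 : (2 : F) = 0 := CharTwo.two_eq_zero
    have hk2 : ((a + 1) * σ x) ^ 2 = (a * x ^ 2) ^ 2 + (T * x) ^ 2 + (D + a + 1) ^ 2 := by
      rw [hk]; grind
    linear_combination (a + 1) ^ 2 * hx' - σ a * hk2 - (a + 1) * σ T * hk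
  exact ⟨hf.subset hsub, (Set.ncard_le_ncard hsub hf).trans hc⟩

theorem ncard_ellipse_param_le_two (hσ : ∀ x, σ (σ x) = x ^ 2) (T D : F) :
    {θ : F | T * θ + σ θ + (D + 1) = 0}.Finite ∧
    {θ : F | T * θ + σ θ + (D + 1) = 0}.ncard ≤ 2 := by
  obtain ⟨hf, hc⟩ := ncard_quadratic_le (a2 := (1 : F)) (σ T * T)
    (σ T * (D + 1) + (σ D + 1)) one_ne_zero
  have hsub : {θ : F | T * θ + σ θ + (D + 1) = 0} ⊆
    {x : F | 1 * x ^ 2 + (σ T * T) * x + (σ T * (D + 1) + (σ D + 1)) = 0} := by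
    intro x hx
    rw [Set.mem_ofPred_eq] at hx ⊢
    have hx' : σ (T * x + σ x + (D + 1)) = 0 := by rw [hx, map_zero]
    simp only [map_add, map_mul, hσ, map_one] at hx'
    have hk : σ x = T * x + (D + 1) := by grind
    rw [hk] at hx'
    grind
  exact ⟨hf.subset hsub, (Set.ncard_le_ncard hsub hf).trans hc⟩

/-- The absolute trace, reduced to the two properties used: invariance under automorphisms and
nondegeneracy. -/
theorem exists_trace_functional [Finite F] : ∃ tr : F →+ ZMod 2,
    (∀ (φ : F ≃+* F) (x : F), tr (φ x) = tr x) ∧ ∀ c, (∀ y, tr (c * y) = 0) → c = 0 := by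
  let _ : Algebra (ZMod 2) F := ZMod.algebra F 2
  refine ⟨(Algebra.trace (ZMod 2) F).toAddMonoidHom, fun φ x => ?_, fun c hc => ?_⟩
  · exact Algebra.trace_eq_of_algEquiv (AlgEquiv.ofRingEquiv (f := φ) (fun r =>
      RingHom.congr_fun (RingHom.ext_zmod (φ.toRingHom.comp (algebraMap (ZMod 2) F))
        (algebraMap (ZMod 2) F)) r)) x
  · exact (traceForm_nondegenerate (ZMod 2) F).1 c hc

/-- There is an ellipse `N(y + 1) = const` of norm type `y ↦ s² + s t + D t²`, with `x² + x + D`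
irreducible, whose parameters on the oval `f(s, t) = t` form a coset of a group of order four. -/
theorem exists_ellipse_four [Finite F] (hσ : ∀ x, σ (σ x) = x ^ 2) {b : F} (hb0 : b ≠ 0)
    (hb1 : b ≠ 1) : ∃ D a x : F, (∀ g, g ^ 2 + g ≠ D) ∧
      ∀ h ∈ ({0, 1, b, b + 1} : Set F),
        a * (x + h) ^ 2 + 1 * (x + h) + (a + 1) * σ (x + h) + (D + a + 1) = 0 := by
  obtain ⟨tr, htr, hnd⟩ := exists_trace_functional (F := F)
  have hsq : ∀ x, tr (x ^ 2) = tr x := fun x => by rw [← hσ, htr, htr]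
  have h1 : b ^ 2 + σ b ≠ 0 := fun h => by
    have h2 : σ (b ^ 2 + σ b) = 0 := by rw [h, map_zero]
    simp only [map_add, map_pow, hσ] at h2
    have h3 : σ b = b ^ 2 := by grind
    have h4 : b ^ 2 * (b + 1) ^ 2 = 0 := by rw [h3] at h2; grind
    have h5 : b + 1 ≠ 0 := fun h => hb1 (by grind)
    simp [hb0, h5] at h4
  have hbσ : b ≠ σ b := fun h => by
    rcases eq_zero_or_one_of_sigma_eq hσ h.symm with h | h
    exacts [hb0 h, hb1 h]
  -- This c makes the additive map h ↦ (c + 1)h² + h + cσ(h) vanish at b; it vanishes at 1 for every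
  -- c.
  set c := (b ^ 2 + b) / (b ^ 2 + σ b) with hc
  have hcb : c * (b ^ 2 + σ b) = b ^ 2 + b := by rw [hc]; field_simp
  have hc1 : c ≠ 1 := fun h => hbσ (by rw [h] at hcb; grind)
  have hc0 : c ≠ 0 := fun h => by
    rw [h] at hcb
    have : b * (b + 1) = 0 := by grind
    rcases mul_eq_zero.1 this with h | h
    exacts [hb0 h, hb1 (by grind)]
  -- D is going to be chosen so that x solves the equation; it then has the trace of c(x² + σ(x) +
  -- 1), and a nonzero trace excludes D = g² + g.
  obtain ⟨x, hx⟩ : ∃ x, tr (c * (x ^ 2 + σ x + 1)) ≠ 0 := by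
    by_contra hcon
    push Not at hcon
    have h2 : tr c = 0 := by simpa using hcon 0
    have h3 : ∀ x, tr (c * x ^ 2) = tr (c * σ x) := fun x => by
      have := hcon x
      rw [mul_add, mul_add, mul_one, map_add, map_add, h2, add_zero] at this
      exact (CharTwo.add_eq_zero).1 this
    -- With x = σ⁻²(y) the relation `h3` reads tr(cy) = tr(cσ⁻¹(y)) = tr(σ(c)y), so σ fixes c and c
    -- would be 0 or 1.
    have h4 : σ c + c = 0 := hnd _ fun y => by
      have h5 := h3 (σ.symm (σ.symm y))
      rw [← hσ, RingEquiv.apply_symm_apply, RingEquiv.apply_symm_apply] at h5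
      have h6 := htr σ (c * σ.symm y)
      rw [map_mul, RingEquiv.apply_symm_apply] at h6
      rw [add_mul, map_add, h6, h5]
      exact CharTwo.add_self_eq_zero _
    rcases eq_zero_or_one_of_sigma_eq hσ (x := c) (by grind) with h | h
    exacts [hc0 h, hc1 h]
  refine ⟨(c + 1) * x ^ 2 + x + c * σ x + c, c + 1, x, fun g hg => hx ?_, ?_⟩
  · have e : c * (x ^ 2 + σ x + 1) = (g ^ 2 + g) + (x ^ 2 + x) := by rw [hg]; grind
    rw [e]
    simp only [map_add, hsq, CharTwo.add_self_eq_zero]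
  · intro h hh
    have key : (c + 1) * h ^ 2 + h + c * σ h = 0 := by
      rcases hh with rfl | rfl | rfl | rfl
      · simp
      · simp; grind
      · grind
      · rw [map_add, map_one]; grind
    rw [map_add]
    grind

end TitsForm

/-! ### Lines and affine points of PG(2, K) in coordinates. -/

section Lines

variable {K : Type*} [Field K]

/-- The line of `PG(2, K)` with coordinate vector `c`. -/
def lineOf (c : Fin 3 → K) : Set (ℙ K (Fin 3 → K)) := {P | c ⬝ᵥ P.rep = 0}

theorem mk_mem_lineOf {c v : Fin 3 → K} (hv : v ≠ 0) :
    Projectivization.mk K v hv ∈ lineOf c ↔ c ⬝ᵥ v = 0 := by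
  obtain ⟨a, ha⟩ := Projectivization.exists_smul_eq_mk_rep K v hv
  rw [lineOf, Set.mem_ofPred_eq, ← ha, Units.smul_def, dotProduct_smul]
  simp

theorem mk_mem_subspacePoints {k V : Type*} [Field k] [AddCommGroup V] [Module k V]
    {W : Submodule k V} {v : V} (hv : v ≠ 0) :
    Projectivization.mk k v hv ∈ subspacePoints W ↔ v ∈ W := by
  rw [subspacePoints, Set.mem_ofPred_eq, Projectivization.submodule_mk,
    Submodule.span_singleton_le_iff_mem]

theorem isLine_iff {l : Set (ℙ K (Fin 3 → K))} : IsLine l ↔ ∃ c, c ≠ 0 ∧ l = lineOf c := by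
  have key : ∀ (W : Submodule K (Fin 3 → K)) (c : Fin 3 → K), (∀ v, v ∈ W ↔ c ⬝ᵥ v = 0) →
      subspacePoints W = lineOf c := fun W c h => by
    ext P
    induction P using Projectivization.ind with
    | h v hv => rw [mk_mem_subspacePoints, mk_mem_lineOf, h]
  constructor
  · rintro ⟨W, hW, rfl⟩
    have hlt : W < ⊤ := by
      refine lt_of_le_of_ne le_top fun h => ?_
      rw [h, finrank_top] at hW
      simp at hW
    obtain ⟨f, hf, hle⟩ := Submodule.exists_le_ker_of_lt_top W hlt
    have hfr := Module.Dual.finrank_ker_add_one_of_ne_zero hf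
    have hWeq : W = LinearMap.ker f := Submodule.eq_of_le_of_finrank_eq hle (by
      rw [hW]; simp at hfr; omega)
    have hfc : ∀ v, f v = (fun i => f fun j => if i = j then 1 else 0) ⬝ᵥ v := fun v => by
      rw [LinearMap.pi_apply_eq_sum_univ f v]
      exact Finset.sum_congr rfl fun i _ => mul_comm _ _
    refine ⟨fun i => f fun j => if i = j then 1 else 0, fun h => hf ?_, key _ _ fun v => ?_⟩
    · refine LinearMap.ext fun v => ?_
      rw [hfc, h, zero_dotProduct, LinearMap.zero_apply]
    · rw [hWeq, LinearMap.mem_ker, hfc]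
  · rintro ⟨c, hc, rfl⟩
    let f : Module.Dual K (Fin 3 → K) := dotProductBilin K K c
    have hf : f ≠ 0 := fun h => hc <| by
      ext i
      have := LinearMap.congr_fun h (Pi.single i 1)
      simpa [f] using this
    have hfr := Module.Dual.finrank_ker_add_one_of_ne_zero hf
    refine ⟨LinearMap.ker f, ?_, (key _ _ fun v => ?_).symm⟩
    · simp at hfr; omega
    · simp [f]

theorem affPt_ne_zero (y z : K) : ![1, y, z] ≠ (0 : Fin 3 → K) := fun h =>
  one_ne_zero (congrFun h 0)

/-- The affine point `(1, y, z)`. -/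
def affPt (y z : K) : ℙ K (Fin 3 → K) := Projectivization.mk K ![1, y, z] (affPt_ne_zero y z)

theorem vertPt_ne_zero : ![0, 0, 1] ≠ (0 : Fin 3 → K) := fun h => one_ne_zero (congrFun h 2)

/-- The point `(0, 0, 1)`. -/
def vertPt (K : Type*) [Field K] : ℙ K (Fin 3 → K) := Projectivization.mk K ![0, 0, 1] vertPt_ne_zero

theorem affPt_mem_lineOf {c : Fin 3 → K} {y z : K} :
    affPt y z ∈ lineOf c ↔ c 0 + c 1 * y + c 2 * z = 0 := by
  rw [affPt, mk_mem_lineOf]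
  simp [dotProduct, Fin.sum_univ_three]

theorem vertPt_mem_lineOf {c : Fin 3 → K} : vertPt K ∈ lineOf c ↔ c 2 = 0 := by
  rw [vertPt, mk_mem_lineOf]
  simp [dotProduct, Fin.sum_univ_three]

theorem affPt_injective {y z y' z' : K} (h : affPt y z = affPt y' z') : y = y' ∧ z = z' := by
  obtain ⟨a, ha⟩ := (Projectivization.mk_eq_mk_iff' K _ _ _ _).1 h
  have h0 := congrFun ha 0
  have h1 := congrFun ha 1
  have h2 := congrFun ha 2
  simp at h0 h1 h2
  subst h0
  simp_all

theorem affPt_ne_vertPt (y z : K) : affPt y z ≠ vertPt K := fun h => by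
  obtain ⟨a, ha⟩ := (Projectivization.mk_eq_mk_iff' K _ _ _ _).1 h
  simpa using congrFun ha 0

end Lines

/-! ### The standard unital and the feet of (1,1,0). -/

section Standard

variable {F K : Type*} [Field F] [Field K] [Algebra F K]

/-- The Buekenhout-Tits unital in standard position. -/
def stdUnital (σ : F ≃+* F) (ε : K) : Set (ℙ K (Fin 3 → K)) :=
  {vertPt K} ∪ {P | ∃ s t r : F, P = affPt (algebraMap F K s + algebraMap F K t * ε)
    (algebraMap F K r + algebraMap F K (titsForm σ s t) * ε)}

theorem rep_unique {ε : K} (hε : ε ∉ Set.range (algebraMap F K)) {a b a' b' : F}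
    (h : algebraMap F K a + algebraMap F K b * ε = algebraMap F K a' + algebraMap F K b' * ε) :
    a = a' ∧ b = b' := by
  have hb : b = b' := by
    by_contra hb
    refine hε ⟨(a' - a) / (b - b'), ?_⟩
    have : algebraMap F K b - algebraMap F K b' ≠ 0 := by
      rw [← map_sub, map_ne_zero]; exact sub_ne_zero.2 hb
    simp only [map_div₀, map_sub]
    field_simp
    linear_combination -h
  subst hb
  exact ⟨(algebraMap F K).injective (by linear_combination h), rfl⟩

theorem rep_eq_zero {ε : K} (hε : ε ∉ Set.range (algebraMap F K)) {a b : F}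
    (h : algebraMap F K a + algebraMap F K b * ε = 0) : a = 0 ∧ b = 0 :=
  rep_unique hε (by rw [h, map_zero, zero_mul, add_zero])

theorem exists_rep (h2 : Module.finrank F K = 2) {ε : K} (hε : ε ∉ Set.range (algebraMap F K))
    (k : K) : ∃ a b : F, k = algebraMap F K a + algebraMap F K b * ε := by
  have hli : LinearIndependent F ![(1 : K), ε] := by
    rw [LinearIndependent.pair_iff]
    intro a b hab
    simp only [Algebra.smul_def] at hab
    exact rep_eq_zero hε (by simpa using hab)
  have : FiniteDimensional F K := Module.finite_of_finrank_pos (by omega)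
  have htop := hli.span_eq_top_of_card_eq_finrank' (by simp [h2])
  have hk : k ∈ Submodule.span F (Set.range ![(1 : K), ε]) := htop ▸ Submodule.mem_top
  rw [Matrix.range_cons, Matrix.range_cons, Matrix.range_empty, Set.union_empty,
    Set.singleton_union, Submodule.mem_span_pair] at hk
  obtain ⟨a, b, rfl⟩ := hk
  exact ⟨a, b, by simp [Algebra.smul_def]⟩

variable {σ : F ≃+* F} {ε : K} {T D : F}

/-- The foot of `(1, 1, 0)` on the standard unital with parameters `(s, t)`, provided that
`f(s, t) = t`. -/
def footPt (ε : K) (T : F) (p : F × F) : ℙ K (Fin 3 → K) :=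
  affPt (algebraMap F K p.1 + algebraMap F K p.2 * ε)
    ((algebraMap F K p.1 + algebraMap F K p.2 * (algebraMap F K T + ε)) *
      (algebraMap F K p.1 + algebraMap F K p.2 * ε + 1))

theorem footPt_injective (hε : ε ∉ Set.range (algebraMap F K)) :
    Function.Injective (footPt ε T) := fun p q h => by
  obtain ⟨h1, h2⟩ := rep_unique hε (affPt_injective h).1
  exact Prod.ext h1 h2

variable [CharP F 2]

/-- Since r is free in the unital, only the ε-component of z = m(y + 1) constrains (s, t), and it
describes a plane section of the ovoid. Tangency at (s, t) forces m = s + tε̄ with ε̄ = T + ε, and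
incidence becomes f(s, t) = t. -/
theorem feet_stdUnital (h2 : Module.finrank F K = 2) (hσ : ∀ x, σ (σ x) = x ^ 2)
    (hε : ε ∉ Set.range (algebraMap F K))
    (hTD : ε ^ 2 = algebraMap F K T * ε + algebraMap F K D) :
    feet (stdUnital σ ε) (affPt 1 0) = footPt ε T '' {p | titsForm σ p.1 p.2 = p.2} := by
  have hchar : CharP K 2 := charP_of_injective_algebraMap (algebraMap F K).injective 2
  have expand : ∀ m0 m1 s t : F, (algebraMap F K m0 + algebraMap F K m1 * (algebraMap F K T + ε)) *
      (algebraMap F K s + algebraMap F K t * ε + 1) =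
      algebraMap F K ((m0 + m1 * T) * (1 + s) + m1 * t * D) +
      algebraMap F K (m1 * s + m0 * t + m1) * ε := fun m0 m1 s t => by
    simp only [map_add, map_mul, map_one]
    grind
  ext Q
  constructor
  · rintro ⟨l, hl, hP, hlU⟩
    obtain ⟨c, hc, rfl⟩ := isLine_iff.1 hl
    rw [affPt_mem_lineOf] at hP
    have hc01 : c 0 = c 1 := by grind
    -- The line y = 1 joining P to (0,0,1) contains a second point of the unital, so it is not
    -- tangent.
    have hc2 : c 2 ≠ 0 := fun hc2 => by
      have m1 : vertPt K ∈ lineOf c ∩ stdUnital σ ε :=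
        ⟨vertPt_mem_lineOf.2 hc2, .inl rfl⟩
      have m2 : affPt (algebraMap F K 1 + algebraMap F K 0 * ε)
          (algebraMap F K 0 + algebraMap F K (titsForm σ 1 0) * ε) ∈
          lineOf c ∩ stdUnital σ ε := by
        refine ⟨?_, .inr ⟨1, 0, 0, rfl⟩⟩
        rw [affPt_mem_lineOf, hc2]
        simp
        grind
      rw [hlU] at m1 m2
      exact affPt_ne_vertPt _ _ (m2.trans m1.symm)
    have hmem : ∀ y z, affPt y z ∈ lineOf c ↔ z = c 1 / c 2 * (y + 1) := fun y z => by
      rw [affPt_mem_lineOf, hc01]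
      field_simp
      constructor <;> intro h <;> grind
    obtain ⟨a, b, hab⟩ := exists_rep h2 hε (c 1 / c 2)
    -- In the basis 1, ε̄ the coordinates of m are exactly the coefficients of the plane f = m₁s +
    -- m₀t + m₁.
    obtain ⟨m0, m1, hm⟩ : ∃ m0 m1 : F, c 1 / c 2 =
        algebraMap F K m0 + algebraMap F K m1 * (algebraMap F K T + ε) :=
      ⟨a + b * T, b, by rw [hab]; simp only [map_add, map_mul]; grind⟩
    have hQ : Q ∈ lineOf c ∩ stdUnital σ ε := hlU ▸ rfl
    obtain ⟨hQl, hQ | ⟨s, t, r, rfl⟩⟩ := hQ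
    · rw [hQ] at hQl
      exact absurd (vertPt_mem_lineOf.1 hQl) hc2
    rw [hmem, hm, expand] at hQl
    have hf := (rep_unique hε hQl).2
    obtain ⟨rfl, rfl⟩ := tangent_of_forall_eq hσ hf fun s' t' h' => by
      have m2 : affPt (algebraMap F K s' + algebraMap F K t' * ε)
          (algebraMap F K ((m0 + m1 * T) * (1 + s') + m1 * t' * D) +
            algebraMap F K (titsForm σ s' t') * ε) ∈ lineOf c ∩ stdUnital σ ε := by
        refine ⟨?_, .inr ⟨s', t', _, rfl⟩⟩
        rw [hmem, hm, expand, h']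
      rw [hlU] at m2
      exact rep_unique hε (affPt_injective m2).1
    refine ⟨(m0, m1), ?_, ?_⟩
    · rw [Set.mem_ofPred_eq]; grind
    · rw [hQl, footPt, ← expand]
  · rintro ⟨⟨s, t⟩, hst, rfl⟩
    rw [Set.mem_ofPred_eq] at hst
    set m := algebraMap F K s + algebraMap F K t * (algebraMap F K T + ε) with hm
    have hmem : ∀ y z, affPt y z ∈ lineOf ![m, m, 1] ↔ z = m * (y + 1) := fun y z => by
      rw [affPt_mem_lineOf]
      simp
      constructor <;> intro h <;> grind
    refine ⟨lineOf ![m, m, 1], isLine_iff.2 ⟨_, fun h => ?_, rfl⟩, ?_, ?_⟩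
    · simpa using congrFun h 2
    · rw [hmem]; grind
    · ext Q
      constructor
      · rintro ⟨hQl, hQ | ⟨s', t', r, rfl⟩⟩
        · rw [hQ] at hQl
          simpa using vertPt_mem_lineOf.1 hQl
        · rw [hmem, hm, expand] at hQl
          have hf := (rep_unique hε hQl).2
          obtain ⟨rfl, rfl⟩ := eq_of_titsForm_tangent hσ (s := s) (t := t) (by rw [hf, hst])
          rw [Set.mem_singleton_iff, footPt, hQl, ← expand]
      · rintro rfl
        refine ⟨(hmem _ _).2 rfl, .inr ⟨s, t, (s + t * T) * (1 + s) + t * t * D, ?_⟩⟩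
        · rw [footPt, expand]
          congr 4
          grind

/-- The parameters of the feet of `(1, 1, 0)` on the line with coordinate vector `c`. -/
def footParams (σ : F ≃+* F) (ε : K) (T : F) (c : Fin 3 → K) : Set (F × F) :=
  {p | titsForm σ p.1 p.2 = p.2 ∧ c 0 + c 1 * (algebraMap F K p.1 + algebraMap F K p.2 * ε) +
    c 2 * ((algebraMap F K p.1 + algebraMap F K p.2 * (algebraMap F K T + ε)) *
      (algebraMap F K p.1 + algebraMap F K p.2 * ε + 1)) = 0}

theorem ncard_line_inter_feet (h2 : Module.finrank F K = 2) (hσ : ∀ x, σ (σ x) = x ^ 2)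
    (hε : ε ∉ Set.range (algebraMap F K))
    (hTD : ε ^ 2 = algebraMap F K T * ε + algebraMap F K D) (c : Fin 3 → K) :
    (lineOf c ∩ feet (stdUnital σ ε) (affPt 1 0)).ncard = (footParams σ ε T c).ncard := by
  rw [feet_stdUnital h2 hσ hε hTD, ← Set.ncard_image_of_injective _ (footPt_injective hε (T := T))]
  congr 1
  ext Q
  constructor
  · rintro ⟨hQ, p, hp, rfl⟩
    exact ⟨p, ⟨hp, affPt_mem_lineOf.1 hQ⟩, rfl⟩
  · rintro ⟨p, ⟨hp, hQ⟩, rfl⟩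
    exact ⟨affPt_mem_lineOf.2 hQ, p, hp, rfl⟩

end Standard

/-! ### Line–ellipse intersections and injectivity of the oval parametrisation. -/

section Counting

variable {F : Type*} [Field F]

theorem ncard_line_inter_ellipse_le [Finite F] {T D : F}
    (hN : ∀ x y : F, x ^ 2 + T * x * y + D * y ^ 2 = 0 → x = 0 ∧ y = 0) {α β : F}
    (h : α ≠ 0 ∨ β ≠ 0) (κ l1 l2 l0 : F) :
    {p : F × F | α * p.1 + β * p.2 = κ ∧
      p.1 ^ 2 + T * p.1 * p.2 + D * p.2 ^ 2 + l1 * p.1 + l2 * p.2 + l0 = 0}.ncard ≤ 2 := by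
  by_cases hα : α = 0
  · have hβ : β ≠ 0 := by simpa [hα] using h
    obtain ⟨hf, hc⟩ := ncard_quadratic_le (a2 := (1 : F)) (T * (κ / β) + l1)
      (D * (κ / β) ^ 2 + l2 * (κ / β) + l0) one_ne_zero
    refine (Set.ncard_le_ncard_of_injOn Prod.fst ?_ ?_ hf).trans hc
    · rintro ⟨x, y⟩ ⟨h1, h2⟩
      simp only [hα, zero_mul, zero_add] at h1 h2
      rw [Set.mem_ofPred_eq, ← h1]
      field_simp
      linear_combination h2
    · rintro ⟨x, y⟩ ⟨h1, -⟩ ⟨x', y'⟩ ⟨h2, -⟩ (rfl : x = x')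
      simp only [hα, zero_mul, zero_add] at h1 h2
      rw [mul_left_cancel₀ hβ (h1.trans h2.symm)]
  -- The quadratic comes from multiplying by α² and eliminating αx; its leading coefficient is the
  -- form at (−β, α), nonzero by anisotropy.
  · obtain ⟨hf, hc⟩ := ncard_quadratic_le (a2 := (-β) ^ 2 + T * (-β) * α + D * α ^ 2)
      (-2 * κ * β + T * α * κ - l1 * α * β + l2 * α ^ 2) (κ ^ 2 + l1 * α * κ + l0 * α ^ 2)
      (fun h => hα (hN _ _ h).2)
    refine (Set.ncard_le_ncard_of_injOn Prod.snd ?_ ?_ hf).trans hc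
    · rintro ⟨x, y⟩ ⟨h1, h2⟩
      simp only at h1 h2
      rw [Set.mem_ofPred_eq, ← h1]
      linear_combination α ^ 2 * h2
    · rintro ⟨x, y⟩ ⟨h1, -⟩ ⟨x', y'⟩ ⟨h2, -⟩ (rfl : y = y')
      have : α * x = α * x' := by simp only at h1 h2; linear_combination h1 - h2
      rw [mul_left_cancel₀ hα this]

/-- The parameters of the points of the oval `f(s, t) = t` other than `(0, 0)`. -/
def ovalPt (σ : F ≃+* F) (θ : F) : F × F := (1 + θ / ovalDenom σ θ, 1 / ovalDenom σ θ)

variable [CharP F 2] {σ : F ≃+* F}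

theorem ovalPt_injective (hσ : ∀ x, σ (σ x) = x ^ 2) : Function.Injective (ovalPt σ) := by
  intro x y h
  have hx := ovalDenom_ne_zero hσ x
  have hy := ovalDenom_ne_zero hσ y
  obtain ⟨h1, h2⟩ := Prod.ext_iff.1 h
  simp only [ovalPt] at h1 h2
  have h3 : ovalDenom σ x = ovalDenom σ y := by simpa using h2
  rw [h3] at h1
  field_simp at h1
  simpa using h1

end Counting

/-! ### Counting feet on a line of the plane. -/

section Params

variable {F K : Type*} [Field F] [Field K] [Algebra F K] {σ : F ≃+* F} {ε : K} {T D : F}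

theorem footParams_div {c : Fin 3 → K} (hc : c 2 ≠ 0) :
    footParams σ ε T c = footParams σ ε T ![c 0 / c 2, c 1 / c 2, 1] := by
  ext p
  refine and_congr_right fun _ => ?_
  simp only [Matrix.cons_val]
  constructor <;> intro h
  · field_simp
    linear_combination h
  · field_simp at h
    linear_combination h

theorem ncard_footParams_vertical_le (hε : ε ∉ Set.range (algebraMap F K)) {c : Fin 3 → K}
    (hc : c ≠ 0) (hc2 : c 2 = 0) : (footParams σ ε T c).ncard ≤ 1 := by
  have : (footParams σ ε T c).Subsingleton := by
    rintro ⟨s, t⟩ ⟨-, h1⟩ ⟨s', t'⟩ ⟨-, h2⟩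
    simp only [hc2, zero_mul, add_zero] at h1 h2
    have hc1 : c 1 ≠ 0 := fun hc1 => hc <| by
      have : c 0 = 0 := by simpa [hc1] using h1
      ext i; fin_cases i <;> assumption
    have := mul_left_cancel₀ hc1 (add_left_cancel (h1.trans h2.symm))
    obtain ⟨h3, h4⟩ := rep_unique hε this
    rw [h3, h4]
  exact (Set.ncard_le_one this.finite).2 fun p hp q hq => this hp hq

theorem ncard_footParams_zero : (footParams σ ε T ![1, 0, 0]).ncard = 0 := by
  have : footParams σ ε T ![1, 0, 0] = ∅ := by
    ext p
    simp [footParams]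
  rw [this, Set.ncard_empty]

theorem ncard_footParams_one (hε : ε ∉ Set.range (algebraMap F K)) :
    (footParams σ ε T ![0, 1, 0]).ncard = 1 := by
  rw [Set.ncard_eq_one]
  refine ⟨(0, 0), ?_⟩
  ext ⟨s, t⟩
  constructor
  · rintro ⟨-, h⟩
    simp only [Matrix.cons_val] at h
    obtain ⟨rfl, rfl⟩ := rep_eq_zero hε (by simpa using h)
    rfl
  · intro h
    obtain ⟨rfl, rfl⟩ := Prod.ext_iff.1 h
    simp [footParams, titsForm]

variable [CharP F 2]

/-- The form is the norm of x + yε: it factors as (x + yε)(x + yε̄) with ε̄ = T + ε. -/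
theorem anisotropic (hε : ε ∉ Set.range (algebraMap F K))
    (hTD : ε ^ 2 = algebraMap F K T * ε + algebraMap F K D) (x y : F)
    (h : x ^ 2 + T * x * y + D * y ^ 2 = 0) : x = 0 ∧ y = 0 := by
  have hchar : CharP K 2 := charP_of_injective_algebraMap (algebraMap F K).injective 2
  by_cases hy : y = 0
  · subst hy
    exact ⟨by simpa using h, rfl⟩
  exfalso
  have h1 := congrArg (algebraMap F K) h
  simp only [map_add, map_mul, map_pow, map_zero] at h1
  have h2 : (algebraMap F K x + algebraMap F K y * ε) *
      (algebraMap F K (x + T * y) + algebraMap F K y * ε) = 0 := by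
    simp only [map_add, map_mul]
    grind
  rcases mul_eq_zero.1 h2 with h3 | h3
  · exact hy (rep_eq_zero hε h3).2
  · exact hy (rep_eq_zero hε h3).2

/-- Comparing coefficients of 1 and ε splits incidence over K into a quadratic and a linear equation
over F. The linear one degenerates exactly when b₀ + b₁ε = 1. -/
theorem footParams_expand (hε : ε ∉ Set.range (algebraMap F K))
    (hTD : ε ^ 2 = algebraMap F K T * ε + algebraMap F K D) (a0 a1 b0 b1 : F) :
    footParams σ ε T ![algebraMap F K a0 + algebraMap F K a1 * ε,
      algebraMap F K b0 + algebraMap F K b1 * ε, 1] =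
    {p | titsForm σ p.1 p.2 = p.2 ∧ b1 * p.1 + (1 + b0 + b1 * T) * p.2 = a1 ∧
      p.1 ^ 2 + T * p.1 * p.2 + D * p.2 ^ 2 + (1 + b0) * p.1 + (T + b1 * D) * p.2 + a0 = 0} := by
  have hchar : CharP K 2 := charP_of_injective_algebraMap (algebraMap F K).injective 2
  ext ⟨s, t⟩
  refine and_congr_right fun _ => ?_
  have e : ∀ x, x = algebraMap F K (s ^ 2 + T * s * t + D * t ^ 2 + (1 + b0) * s +
      (T + b1 * D) * t + a0) + algebraMap F K (b1 * s + (1 + b0 + b1 * T) * t + a1) * ε →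
      (x = 0 ↔ b1 * s + (1 + b0 + b1 * T) * t = a1 ∧
      s ^ 2 + T * s * t + D * t ^ 2 + (1 + b0) * s + (T + b1 * D) * t + a0 = 0) := by
    rintro _ rfl
    constructor
    · intro h
      obtain ⟨h1, h2⟩ := rep_eq_zero hε h
      exact ⟨by grind, h1⟩
    · rintro ⟨h1, h2⟩
      rw [h1, h2]
      grind
  refine e _ ?_
  simp only [map_add, map_mul, map_pow, map_one, Matrix.cons_val]
  grind

theorem ncard_footParams_le_two [Finite F] (h2 : Module.finrank F K = 2)
    (hε : ε ∉ Set.range (algebraMap F K))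
    (hTD : ε ^ 2 = algebraMap F K T * ε + algebraMap F K D) (a : K) {b : K} (hb : b ≠ 1) :
    (footParams σ ε T ![a, b, 1]).ncard ≤ 2 := by
  obtain ⟨a0, a1, rfl⟩ := exists_rep h2 hε a
  obtain ⟨b0, b1, rfl⟩ := exists_rep h2 hε b
  rw [footParams_expand hε hTD]
  refine (Set.ncard_le_ncard (fun p hp => hp.2) (Set.toFinite _)).trans
    (ncard_line_inter_ellipse_le (anisotropic hε hTD) ?_ _ _ _ _)
  by_contra hcon
  push Not at hcon
  obtain ⟨rfl, h⟩ := hcon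
  have : b0 = 1 := by grind
  subst this
  simp at hb

theorem footParams_eq (hσ : ∀ x, σ (σ x) = x ^ 2) (hε : ε ∉ Set.range (algebraMap F K))
    (hTD : ε ^ 2 = algebraMap F K T * ε + algebraMap F K D) (a : F) :
    footParams σ ε T ![algebraMap F K a, 1, 1] = {p | p = (0, 0) ∧ a = 0} ∪
      ovalPt σ '' {θ | a * θ ^ 2 + T * θ + (a + 1) * σ θ + (D + a + 1) = 0} := by
  have h := footParams_expand (σ := σ) hε hTD a 0 1 0
  have h11 : (1 : F) + 1 = 0 := CharTwo.add_self_eq_zero 1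
  simp only [map_zero, zero_mul, add_zero, map_one, h11] at h
  rw [h]
  ext ⟨s, t⟩
  constructor
  · rintro ⟨h1, -, h3⟩
    rcases oval_cases hσ h1 with ⟨rfl, rfl⟩ | ⟨θ, rfl, rfl⟩
    · left
      exact ⟨rfl, by simpa using h3⟩
    · right
      exact ⟨θ, (oval_mem_ellipse_iff hσ T D a θ).1 h3, rfl⟩
  · rintro (⟨h1, rfl⟩ | ⟨θ, hθ, hp⟩)
    · obtain ⟨rfl, rfl⟩ := Prod.ext_iff.1 h1
      simp [titsForm]
    · obtain ⟨rfl, rfl⟩ := Prod.ext_iff.1 hp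
      exact ⟨titsForm_oval hσ θ, by simp, (oval_mem_ellipse_iff hσ T D a θ).2 hθ⟩

theorem footParams_one_of_nonempty (h2 : Module.finrank F K = 2)
    (hε : ε ∉ Set.range (algebraMap F K))
    (hTD : ε ^ 2 = algebraMap F K T * ε + algebraMap F K D) {a : K}
    (h : (footParams σ ε T ![a, 1, 1]).Nonempty) : ∃ a0 : F, a = algebraMap F K a0 := by
  obtain ⟨a0, a1, rfl⟩ := exists_rep h2 hε a
  have he := footParams_expand (σ := σ) hε hTD a0 a1 1 0
  have h11 : (1 : F) + 1 = 0 := CharTwo.add_self_eq_zero 1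
  simp only [map_zero, zero_mul, add_zero, map_one, h11] at he
  rw [he] at h
  obtain ⟨p, -, rfl, -⟩ := h
  exact ⟨a0, by simp⟩

theorem ncard_footParams_le_four [Finite F] (h2 : Module.finrank F K = 2)
    (hσ : ∀ x, σ (σ x) = x ^ 2) (hε : ε ∉ Set.range (algebraMap F K))
    (hTD : ε ^ 2 = algebraMap F K T * ε + algebraMap F K D) {c : Fin 3 → K} (hc : c ≠ 0) :
    (footParams σ ε T c).ncard ≤ 4 := by
  by_cases hc2 : c 2 = 0
  · exact (ncard_footParams_vertical_le hε hc hc2).trans (by norm_num)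
  rw [footParams_div hc2]
  by_cases hb : c 1 / c 2 = 1
  · rw [hb]
    rcases (footParams σ ε T ![c 0 / c 2, 1, 1]).eq_empty_or_nonempty with he | hne
    · simp [he]
    obtain ⟨a, ha⟩ := footParams_one_of_nonempty h2 hε hTD hne
    rw [ha, footParams_eq hσ hε hTD]
    refine (Set.ncard_union_le _ _).trans ?_
    rw [Set.ncard_image_of_injective _ (ovalPt_injective hσ)]
    -- For a = 0 the foot (0,0) also lies on the line, but the equation in θ has at most two
    -- solutions, so the total is at most three.
    by_cases ha0 : a = 0
    · subst ha0
      have h1 : {p : F × F | p = (0, 0) ∧ (0 : F) = 0}.ncard ≤ 1 :=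
        Set.ncard_le_one_iff_subsingleton.2 fun p hp q hq => hp.1.trans hq.1.symm
      have h3 := (ncard_ellipse_param_le_two hσ T D).2
      simp only [zero_mul, zero_add, one_mul, add_zero]
      simp only [and_true] at h1 ⊢
      omega
    · have h3 := (ncard_ellipse_param_le hσ T D ha0).2
      simpa [ha0] using h3
  · exact (ncard_footParams_le_two h2 hε hTD _ hb).trans (by norm_num)

theorem ovalPt_ne_zero (hσ : ∀ x, σ (σ x) = x ^ 2) (θ : F) : ovalPt σ θ ≠ (0, 0) := fun h => by
  have := (Prod.ext_iff.1 h).2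
  simp [ovalPt, ovalDenom_ne_zero hσ] at this

theorem ncard_footParams_three (hσ : ∀ x, σ (σ x) = x ^ 2)
    (hε : ε ∉ Set.range (algebraMap F K)) (hTD : ε ^ 2 = ε + 1) :
    (footParams σ ε 1 ![0, 1, 1]).ncard = 3 := by
  have h := footParams_eq (σ := σ) (T := 1) (D := 1) hσ hε (by simpa using hTD) 0
  rw [map_zero] at h
  have hE : {θ : F | 0 * θ ^ 2 + 1 * θ + (0 + 1) * σ θ + (1 + 0 + 1) = 0} = {0, 1} := by
    ext x
    constructor
    · intro hx
      rw [Set.mem_ofPred_eq] at hx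
      exact eq_zero_or_one_of_sigma_eq hσ (by grind)
    · rintro (rfl | rfl)
      · rw [Set.mem_ofPred_eq]; rw [map_zero]; grind
      · rw [Set.mem_ofPred_eq]; rw [map_one]; grind
  rw [h, hE, Set.image_pair]
  have : {p : F × F | p = (0, 0) ∧ (0 : F) = 0} = {(0, 0)} := by ext; simp
  rw [this, Set.singleton_union, Set.ncard_eq_three]
  exact ⟨_, _, _, (ovalPt_ne_zero hσ _).symm, (ovalPt_ne_zero hσ _).symm,
    fun h => zero_ne_one (ovalPt_injective hσ h), rfl⟩

theorem exists_ncard_footParams_two [Finite F] (h2 : Module.finrank F K = 2)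
    (hσ : ∀ x, σ (σ x) = x ^ 2) (hε : ε ∉ Set.range (algebraMap F K)) (hTD : ε ^ 2 = ε + 1)
    {b : F} (hb0 : b ≠ 0) (hb1 : b ≠ 1) :
    ∃ c : Fin 3 → K, c ≠ 0 ∧ (footParams σ ε 1 c).ncard = 2 := by
  have hTD' : ε ^ 2 = algebraMap F K 1 * ε + algebraMap F K 1 := by simpa using hTD
  have hchar : CharP K 2 := charP_of_injective_algebraMap (algebraMap F K).injective 2
  obtain ⟨s, hs⟩ : ∃ s, s = (ovalPt σ b).1 := ⟨_, rfl⟩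
  obtain ⟨t, ht⟩ : ∃ t, t = (ovalPt σ b).2 := ⟨_, rfl⟩
  have hst : ovalPt σ b = (s, t) := by rw [hs, ht]
  have hy : algebraMap F K s + algebraMap F K t * ε ≠ 0 := fun h => by
    obtain ⟨h1, h2⟩ := rep_eq_zero hε (by simpa using h)
    exact ovalPt_ne_zero hσ b (by rw [hst, h1, h2])
  set y := algebraMap F K s + algebraMap F K t * ε with hydef
  set z := (algebraMap F K s + algebraMap F K t * (algebraMap F K 1 + ε)) * (y + 1) with hzdef
  have m1 : ((0, 0) : F × F) ∈ footParams σ ε 1 ![0, z / y, 1] := by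
    simp [footParams, titsForm]
  have m2 : ovalPt σ b ∈ footParams σ ε 1 ![0, z / y, 1] := by
    refine ⟨titsForm_oval hσ b, ?_⟩
    rw [hst]
    simp only [Matrix.cons_val, ← hydef, ← hzdef]
    field_simp
    grind
  refine ⟨![0, z / y, 1], fun h => by simpa using congrFun h 2, le_antisymm ?_ ?_⟩
  -- Were the slope 1, the line would be the one with three feet, whose parameters satisfy σ(θ) = θ,
  -- contrary to b ≠ 0, 1.
  · refine ncard_footParams_le_two h2 hε hTD' _ fun h => ?_
    rw [h] at m2
    have he := footParams_eq (σ := σ) (T := 1) (D := 1) hσ hε hTD' 0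
    rw [map_zero] at he
    rw [he] at m2
    rcases m2 with m2 | ⟨θ, hθ, hm⟩
    · exact ovalPt_ne_zero hσ b m2.1
    · rw [ovalPt_injective hσ hm, Set.mem_ofPred_eq] at hθ
      rcases eq_zero_or_one_of_sigma_eq hσ (x := b) (by grind) with h | h
      exacts [hb0 h, hb1 h]
  · refine (Set.ncard_pair (ovalPt_ne_zero hσ b).symm).symm.trans_le ?_
    refine Set.ncard_le_ncard ?_ (Set.toFinite _)
    rintro p (rfl | rfl)
    exacts [m1, m2]

theorem ncard_footParams_four [Finite F] (h2 : Module.finrank F K = 2)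
    (hσ : ∀ x, σ (σ x) = x ^ 2) (hε : ε ∉ Set.range (algebraMap F K))
    (hTD : ε ^ 2 = ε + algebraMap F K D) {a b x : F} (hb0 : b ≠ 0) (hb1 : b ≠ 1)
    (h : ∀ h ∈ ({0, 1, b, b + 1} : Set F),
      a * (x + h) ^ 2 + 1 * (x + h) + (a + 1) * σ (x + h) + (D + a + 1) = 0) :
    (footParams σ ε 1 ![algebraMap F K a, 1, 1]).ncard = 4 := by
  have hTD' : ε ^ 2 = algebraMap F K 1 * ε + algebraMap F K D := by simpa using hTD
  refine le_antisymm (ncard_footParams_le_four h2 hσ hε hTD' fun h => by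
    simpa using congrFun h 2) ?_
  have hcard : ({0, 1, b, b + 1} : Set F).ncard = 4 := by
    rw [Set.ncard_eq_four]
    refine ⟨0, 1, b, b + 1, zero_ne_one, hb0.symm, ?_, hb1.symm, ?_, ?_, rfl⟩
    · exact fun h => hb1 (by grind)
    · exact fun h => hb0 (by grind)
    · simp
  rw [← hcard, ← Set.ncard_image_of_injective _
    ((ovalPt_injective hσ).comp (add_right_injective x)), footParams_eq hσ hε hTD']
  refine Set.ncard_le_ncard ?_ (Set.toFinite _)
  rintro _ ⟨y, hy, rfl⟩
  exact .inr ⟨_, h y hy, rfl⟩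

end Params

/-! ### Projecting the cone from its vertex. -/

section Cone

variable {F : Type*} [Field F] {σ : F ≃+* F}

/-- `x` is zero or represents a point of the standard Tits ovoid. -/
def IsTitsVec (σ : F ≃+* F) (x : Fin 4 → F) : Prop :=
  (∃ c s t : F, x = c • ![1, s, t, titsForm σ s t]) ∨ ∃ c : F, x = c • ![0, 0, 0, 1]

theorem mk_mem_standardTitsOvoid {e : ℕ} (he : ∀ x, σ x = x ^ 2 ^ (e + 1)) {x : Fin 4 → F}
    (hx : x ≠ 0) : Projectivization.mk F x hx ∈ standardTitsOvoid F e ↔ IsTitsVec σ x := by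
  have hf : ∀ s t : F, s ^ (2 ^ (e + 1) + 2) + t ^ (2 ^ (e + 1)) + s * t = titsForm σ s t :=
    fun s t => by rw [titsForm, he, he, pow_add]
  rw [standardTitsOvoid, Set.mem_union, or_comm]
  refine or_congr ?_ ?_
  · simp only [Set.mem_ofPred_eq, Projectivization.mk_eq_mk_iff', hf]
    constructor
    · rintro ⟨s, t, c, h⟩
      exact ⟨c, s, t, h.symm⟩
    · rintro ⟨c, s, t, h⟩
      exact ⟨s, t, c, h.symm⟩
  · rw [Set.mem_singleton_iff, Projectivization.mk_eq_mk_iff']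
    exact exists_congr fun c => eq_comm

theorem IsTitsVec.smul {x : Fin 4 → F} (h : IsTitsVec σ x) (c : F) : IsTitsVec σ (c • x) := by
  rcases h with ⟨d, s, t, rfl⟩ | ⟨d, rfl⟩
  · exact .inl ⟨c * d, s, t, by rw [mul_smul]⟩
  · exact .inr ⟨c * d, by rw [mul_smul]⟩

theorem isTitsVec_smul_iff {x : Fin 4 → F} {c : F} (hc : c ≠ 0) :
    IsTitsVec σ (c • x) ↔ IsTitsVec σ x :=
  ⟨fun h => by simpa [smul_smul, hc] using h.smul c⁻¹, fun h => h.smul c⟩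

theorem isTitsVec_affine_iff {s t m : F} :
    IsTitsVec σ ![1, s, t, m] ↔ m = titsForm σ s t := by
  constructor
  · rintro (⟨c, s', t', h⟩ | ⟨c, h⟩)
    · have h0 := congrFun h 0
      have h1 := congrFun h 1
      have h2 := congrFun h 2
      have h3 := congrFun h 3
      simp at h0 h1 h2 h3
      subst h0
      simp_all
    · simpa using congrFun h 0
  · rintro rfl
    exact .inl ⟨1, s, t, by simp⟩

theorem IsTitsVec.of_apply_zero {x : Fin 4 → F} (h : IsTitsVec σ x) (h0 : x 0 = 0) :
    x 1 = 0 ∧ x 2 = 0 := by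
  rcases h with ⟨c, s, t, rfl⟩ | ⟨c, rfl⟩
  · have : c = 0 := by simpa using h0
    simp [this]
  · simp

theorem isTitsVec_vert (m : F) : IsTitsVec σ ![0, 0, 0, m] := .inr ⟨m, by simp⟩

theorem exists_projection_of_isTitsCone {M : Type*} [AddCommGroup M] [Module F M]
    [FiniteDimensional F M] (hM : Module.finrank F M = 5) {e : ℕ}
    (he : ∀ x, σ x = x ^ 2 ^ (e + 1)) {C : Set (ℙ F M)} (hC : IsTitsCone e C) :
    ∃ (Ψ : M →ₗ[F] (Fin 4 → F)) (n : M), n ≠ 0 ∧ Function.Surjective Ψ ∧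
      (∀ v, Ψ v = 0 ↔ ∃ c : F, v = c • n) ∧
      ∀ v hv, Projectivization.mk F v hv ∈ C ↔ IsTitsVec σ (Ψ v) := by
  obtain ⟨H, O, N, ⟨φ, hφ, rfl, rfl⟩, hN, rfl⟩ := hC
  induction N using Projectivization.ind with
  | h n hn =>
  rw [mk_mem_subspacePoints] at hN
  let Φ : (Fin 4 → F) × F →ₗ[F] M := φ.coprod (LinearMap.toSpanSingleton F M n)
  have hΦ : ∀ x r, Φ (x, r) = φ x + r • n := fun x r => by simp [Φ]
  have hinj : Function.Injective Φ := by
    rw [← LinearMap.ker_eq_bot, LinearMap.ker_eq_bot']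
    rintro ⟨x, r⟩ h
    rw [hΦ] at h
    have hr : r = 0 := by
      by_contra hr
      refine hN ⟨-(r⁻¹ • x), ?_⟩
      have : φ x = -(r • n) := eq_neg_of_add_eq_zero_left h
      rw [map_neg, map_smul, this, smul_neg, neg_neg, smul_smul, inv_mul_cancel₀ hr, one_smul]
    subst hr
    rw [zero_smul, add_zero] at h
    rw [hφ (h.trans (map_zero φ).symm)]
    rfl
  let Φe := LinearEquiv.ofInjectiveOfFinrankEq Φ hinj (by simp [hM])
  have hΦe : ∀ p, Φe p = Φ p := fun p => rfl
  have hrepr : ∀ v : M, ∃ x r, v = φ x + r • n ∧ (LinearMap.fst F _ _ ∘ₗ Φe.symm.toLinearMap) v = x :=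
    fun v => ⟨(Φe.symm v).1, (Φe.symm v).2, by rw [← hΦ, ← hΦe]; simp, rfl⟩
  have hval : ∀ x r, (LinearMap.fst F _ _ ∘ₗ Φe.symm.toLinearMap) (φ x + r • n) = x := fun x r => by
    rw [← hΦ, ← hΦe]; simp
  generalize (LinearMap.fst F _ _ ∘ₗ Φe.symm.toLinearMap) = Ψ at hrepr hval
  refine ⟨Ψ, n, hn, fun x => ⟨φ x + (0 : F) • n, hval x 0⟩, fun v => ?_, fun v hv => ?_⟩
  · constructor
    · intro h
      obtain ⟨x, r, hv, hx⟩ := hrepr v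
      refine ⟨r, ?_⟩
      rw [hv, ← hx, h, map_zero, zero_add]
    · rintro ⟨c, rfl⟩
      simpa using hval 0 c
  · rw [coneOver]
    simp only [Set.mem_iUnion, exists_prop, mk_mem_subspacePoints]
    constructor
    · rintro ⟨Q, ⟨Q', hQ', rfl⟩, hv⟩
      induction Q' using Projectivization.ind with
      | h x hx =>
      rw [mk_mem_standardTitsOvoid he] at hQ'
      rw [Projectivization.map_mk, Projectivization.submodule_mk, Projectivization.submodule_mk,
        Submodule.mem_sup] at hv
      obtain ⟨y, hy, z, hz, rfl⟩ := hv
      obtain ⟨r, rfl⟩ := Submodule.mem_span_singleton.1 hy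
      obtain ⟨c, rfl⟩ := Submodule.mem_span_singleton.1 hz
      rw [← map_smul, add_comm, hval]
      exact hQ'.smul c
    · intro h
      obtain ⟨x, r, hvx, hx⟩ := hrepr v
      rw [hx] at h
      -- If v represents the vertex then x = 0; taking c = 0 with a nonzero y covers this case.
      have : ∃ (y : Fin 4 → F) (c : F), y ≠ 0 ∧ IsTitsVec σ y ∧ x = c • y := by
        rcases h with ⟨c, s, t, rfl⟩ | ⟨c, rfl⟩
        · exact ⟨_, c, affinePoint_ne_zero s t _, .inl ⟨1, s, t, (one_smul _ _).symm⟩, rfl⟩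
        · exact ⟨_, c, pointAtInfinity_ne_zero, .inr ⟨1, (one_smul _ _).symm⟩, rfl⟩
      obtain ⟨y, c, hy, hty, rfl⟩ := this
      refine ⟨_, ⟨Projectivization.mk F y hy, (mk_mem_standardTitsOvoid he hy).2 hty, rfl⟩, ?_⟩
      rw [Projectivization.map_mk, Projectivization.submodule_mk, Projectivization.submodule_mk,
        Submodule.mem_sup]
      exact ⟨r • n, Submodule.smul_mem _ _ (Submodule.mem_span_singleton_self _), c • φ y,
        Submodule.smul_mem _ _ (Submodule.mem_span_singleton_self _), by
          rw [hvx, map_smul, add_comm]⟩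

end Cone

/-! ### Collineations of the Tits ovoid. -/

section Automorphisms

variable {F : Type*} [Field F] {σ : F ≃+* F}

/-- The collineation of the Tits ovoid acting as `(s, t) ↦ (s + a, t + b + σ(a) s)`. -/
def titsTransl (σ : F ≃+* F) (a b : F) : (Fin 4 → F) →ₗ[F] (Fin 4 → F) where
  toFun x := ![x 0, x 1 + a * x 0, x 2 + b * x 0 + σ a * x 1,
    x 3 + (b + σ a * a) * x 1 + a * x 2 + titsForm σ a b * x 0]
  map_add' x y := by ext i; fin_cases i <;> simp <;> ring
  map_smul' c x := by ext i; fin_cases i <;> simp <;> ring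

/-- The collineation of the Tits ovoid acting as `(s, t) ↦ (l s, l σ(l) t)`. -/
def titsDiag (σ : F ≃+* F) (l : F) : (Fin 4 → F) →ₗ[F] (Fin 4 → F) where
  toFun x := ![x 0, l * x 1, l * σ l * x 2, l ^ 2 * σ l * x 3]
  map_add' x y := by ext i; fin_cases i <;> simp <;> ring
  map_smul' c x := by ext i; fin_cases i <;> simp <;> ring

/-- The reversal of the coordinates. -/
def titsSwap (F : Type*) [Field F] : (Fin 4 → F) →ₗ[F] (Fin 4 → F) where
  toFun x := ![x 3, x 2, x 1, x 0]
  map_add' x y := by ext i; fin_cases i <;> simp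
  map_smul' c x := by ext i; fin_cases i <;> simp

theorem titsTransl_apply (a b : F) (x : Fin 4 → F) : titsTransl σ a b x =
    ![x 0, x 1 + a * x 0, x 2 + b * x 0 + σ a * x 1,
    x 3 + (b + σ a * a) * x 1 + a * x 2 + titsForm σ a b * x 0] := rfl

theorem titsDiag_apply (l : F) (x : Fin 4 → F) : titsDiag σ l x =
    ![x 0, l * x 1, l * σ l * x 2, l ^ 2 * σ l * x 3] := rfl

theorem titsSwap_apply (x : Fin 4 → F) : titsSwap F x = ![x 3, x 2, x 1, x 0] := rfl

/-- A surjective linear map preserving the Tits ovoid. -/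
def IsTitsAut (σ : F ≃+* F) (h : (Fin 4 → F) →ₗ[F] (Fin 4 → F)) : Prop :=
  Function.Surjective h ∧ ∀ x, IsTitsVec σ (h x) ↔ IsTitsVec σ x

theorem IsTitsAut.of_inverse {h h' : (Fin 4 → F) →ₗ[F] (Fin 4 → F)} (h1 : ∀ x, h' (h x) = x)
    (h2 : ∀ x, h (h' x) = x) (t1 : ∀ x, IsTitsVec σ x → IsTitsVec σ (h x))
    (t2 : ∀ x, IsTitsVec σ x → IsTitsVec σ (h' x)) : IsTitsAut σ h :=
  ⟨fun x => ⟨h' x, h2 x⟩, fun x => ⟨fun hx => h1 x ▸ t2 _ hx, t1 x⟩⟩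

theorem IsTitsAut.id : IsTitsAut σ LinearMap.id := ⟨fun x => ⟨x, rfl⟩, fun _ => Iff.rfl⟩

theorem IsTitsAut.comp {h h' : (Fin 4 → F) →ₗ[F] (Fin 4 → F)} (hh : IsTitsAut σ h)
    (hh' : IsTitsAut σ h') : IsTitsAut σ (h ∘ₗ h') :=
  ⟨hh.1.comp hh'.1, fun x => (hh.2 _).trans (hh'.2 x)⟩

theorem isTitsAut_smul {c : F} (hc : c ≠ 0) : IsTitsAut σ (c • LinearMap.id) :=
  ⟨fun x => ⟨c⁻¹ • x, by simp [smul_smul, hc]⟩, fun _ => isTitsVec_smul_iff hc⟩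

theorem isTitsAut_diag (hσ : ∀ x, σ (σ x) = x ^ 2) {l : F} (hl : l ≠ 0) :
    IsTitsAut σ (titsDiag σ l) := by
  have hl' : σ l ≠ 0 := by simpa using hl
  have key : ∀ l x, IsTitsVec σ x → IsTitsVec σ (titsDiag σ l x) := by
    rintro l _ (⟨c, s, t, rfl⟩ | ⟨c, rfl⟩)
    · refine .inl ⟨c, l * s, l * σ l * t, ?_⟩
      rw [map_smul, titsDiag_apply, titsForm_diag hσ]
      simp
    · refine .inr ⟨c * (l ^ 2 * σ l), ?_⟩
      rw [map_smul, titsDiag_apply, mul_smul]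
      simp
  refine IsTitsAut.of_inverse (h' := titsDiag σ l⁻¹) ?_ ?_ (key _) (key _)
  all_goals
    intro x
    rw [titsDiag_apply, titsDiag_apply]
    ext i
    fin_cases i <;> simp <;> field_simp

variable [CharP F 2]

theorem isTitsAut_transl (hσ : ∀ x, σ (σ x) = x ^ 2) (a b : F) :
    IsTitsAut σ (titsTransl σ a b) := by
  have key : ∀ a b x, IsTitsVec σ x → IsTitsVec σ (titsTransl σ a b x) := by
    rintro a b _ (⟨c, s, t, rfl⟩ | ⟨c, rfl⟩)
    · refine .inl ⟨c, s + a, t + b + σ a * s, ?_⟩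
      rw [map_smul, titsTransl_apply, titsForm_translate hσ]
      simp
    · refine .inr ⟨c, ?_⟩
      rw [map_smul, titsTransl_apply]
      simp
  -- The translations form a noncommutative group, whence the correction σ(a)a in the inverse.
  refine IsTitsAut.of_inverse (h' := titsTransl σ a (b + σ a * a)) ?_ ?_ (key _ _) (key _ _)
  all_goals
    intro x
    rw [titsTransl_apply, titsTransl_apply]
    ext i
    fin_cases i <;> simp [titsForm, hσ] <;> grind

theorem isTitsAut_swap (hσ : ∀ x, σ (σ x) = x ^ 2) : IsTitsAut σ (titsSwap F) := by
  have key : ∀ x, IsTitsVec σ x → IsTitsVec σ (titsSwap F x) := by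
    rintro _ (⟨c, s, t, rfl⟩ | ⟨c, rfl⟩)
    · by_cases hz : titsForm σ s t = 0
      · obtain ⟨rfl, rfl⟩ := (titsForm_eq_zero_iff hσ).1 hz
        refine .inr ⟨c, ?_⟩
        rw [map_smul, titsSwap_apply]
        simp [hz]
      · refine .inl ⟨c * titsForm σ s t, t / titsForm σ s t, s / titsForm σ s t, ?_⟩
        rw [map_smul, titsSwap_apply, mul_smul, titsForm_swap hσ hz]
        congr 1
        ext i
        fin_cases i <;> simp <;> field_simp
    · refine .inl ⟨c, 0, 0, ?_⟩
      rw [map_smul, titsSwap_apply]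
      simp [titsForm]
  refine IsTitsAut.of_inverse (h' := titsSwap F) ?_ ?_ key key
  all_goals
    intro x
    rw [titsSwap_apply, titsSwap_apply]
    ext i
    fin_cases i <;> simp

theorem exists_isTitsAut_map_vert (hσ : ∀ x, σ (σ x) = x ^ 2) {x : Fin 4 → F}
    (hx : IsTitsVec σ x) : ∃ h, IsTitsAut σ h ∧ ∃ m : F, h x = ![0, 0, 0, m] := by
  rcases hx with ⟨c, s, t, rfl⟩ | ⟨c, rfl⟩
  · refine ⟨_, (isTitsAut_swap hσ).comp (isTitsAut_transl hσ s (t + σ s * s)), c, ?_⟩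
    rw [map_smul, LinearMap.comp_apply, titsTransl_apply, titsSwap_apply]
    ext i
    fin_cases i <;> simp [titsForm, hσ] <;> grind
  · exact ⟨_, IsTitsAut.id, c, by simp⟩

end Automorphisms

theorem vec4_ext {R : Type*} {x : Fin 4 → R} {a b c d : R} (h0 : x 0 = a) (h1 : x 1 = b)
    (h2 : x 2 = c) (h3 : x 3 = d) : x = ![a, b, c, d] := by
  ext i; fin_cases i <;> simpa

/-! ### Normalising the projection relative to the hyperplane at infinity and the spread. -/

section Projection

variable {F K : Type*} [Field F] [Field K] [Algebra F K] {σ : F ≃+* F}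

/-- A projection from `PG(4, q)` onto `PG(3, q)` whose centre is at infinity on the spread element
of `w`, mapping the hyperplane at infinity to the plane `x₀ = 0` and the spread element to the
point `(0, 0, 0, 1)`. -/
structure IsConeProj (Ψ : F × (K × K) →ₗ[F] (Fin 4 → F)) (w : K × K) : Prop where
  surj : Function.Surjective Ψ
  apply_zero : ∀ v, Ψ v 0 = v.1
  ne_zero : w ≠ 0
  spread : ∀ k : K × K, (Ψ (0, k) 1 = 0 ∧ Ψ (0, k) 2 = 0) ↔ ∃ c : K, k = c • w

theorem isTitsAut_injective {h : (Fin 4 → F) →ₗ[F] (Fin 4 → F)} (hh : IsTitsAut σ h) :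
    Function.Injective h := LinearMap.injective_iff_surjective.2 hh.1

theorem exists_isConeProj [CharP F 2] (h2 : Module.finrank F K = 2)
    (hσ : ∀ x, σ (σ x) = x ^ 2) {ε : K} (hε : ε ∉ Set.range (algebraMap F K))
    {Ψ : F × (K × K) →ₗ[F] (Fin 4 → F)} {n : F × (K × K)}
    (hsurj : Function.Surjective Ψ) (hker : ∀ v, Ψ v = 0 ↔ ∃ c : F, v = c • n) (hn : n ≠ 0)
    {w : K × K} (hw : w ≠ 0)
    (hsp : ∀ v : F × (K × K), (v.1 = 0 ∧ IsTitsVec σ (Ψ v)) ↔ ∃ c : K, v = (0, c • w)) :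
    ∃ Ψ' : F × (K × K) →ₗ[F] (Fin 4 → F), IsConeProj Ψ' w ∧
      ∀ v, IsTitsVec σ (Ψ' v) ↔ IsTitsVec σ (Ψ v) := by
  have hΨn : Ψ n = 0 := (hker n).2 ⟨1, by simp⟩
  -- The vertex is at infinity: otherwise Ψ maps the hyperplane onto PG(3,q), so the spread element
  -- contains vectors over two ovoid points, and their sum would lie over the ovoid, which has no
  -- three collinear points.
  have hn1 : n.1 = 0 := by
    by_contra hn1
    have hex : ∀ x, ∃ v, Ψ v = x ∧ v.1 = 0 := fun x => by
      obtain ⟨v, rfl⟩ := hsurj x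
      refine ⟨v - (v.1 / n.1) • n, by simp [hΨn], ?_⟩
      simp [hn1]
    obtain ⟨u, hu, hu1⟩ := hex ![0, 0, 0, 1]
    obtain ⟨v, hv, hv1⟩ := hex ![1, 0, 0, 0]
    obtain ⟨c, hc⟩ := (hsp u).1 ⟨hu1, hu ▸ isTitsVec_vert 1⟩
    obtain ⟨d, hd⟩ := (hsp v).1 ⟨hv1, hv ▸ isTitsVec_affine_iff.2 (by simp [titsForm])⟩
    have h3 := ((hsp (u + v)).2 ⟨c + d, by rw [hc, hd, add_smul]; simp⟩).2
    have e : Ψ (u + v) = ![1, 0, 0, 1] := by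
      rw [map_add, hu, hv]; ext i; fin_cases i <;> simp
    rw [e, isTitsVec_affine_iff] at h3
    simp [titsForm] at h3
  obtain ⟨kn, rfl⟩ := (hsp n).1 ⟨hn1, hΨn ▸ .inr ⟨0, by simp⟩⟩
  have hkn : kn ≠ 0 := by rintro rfl; simp at hn
  -- Together with the vertex this vector spans the spread element, which therefore projects to a
  -- single ovoid point; that point is moved to (0,0,0,1).
  have hTx : IsTitsVec σ (Ψ (0, (ε * kn) • w)) := ((hsp _).2 ⟨_, rfl⟩).2
  obtain ⟨h, hh, m, hm⟩ := exists_isTitsAut_map_vert hσ hTx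
  have hinj := isTitsAut_injective hh
  have hm0 : m ≠ 0 := by
    rintro rfl
    have h0 : h (Ψ (0, (ε * kn) • w)) = 0 := by rw [hm]; ext i; fin_cases i <;> rfl
    obtain ⟨c, hc⟩ := (hker _).1 (hinj (h0.trans (map_zero h).symm))
    refine hε ⟨c, ?_⟩
    have h1 : (ε * kn) • w = (algebraMap F K c * kn) • w := by
      simpa [mul_smul] using (Prod.ext_iff.1 hc).2
    exact (mul_right_cancel₀ hkn (smul_left_injective K hw h1)).symm
  have hvert : ∀ c : K, ∃ m', h (Ψ (0, c • w)) = ![0, 0, 0, m'] := fun c => by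
    obtain ⟨a, b, hab⟩ := exists_rep h2 hε (c / kn)
    refine ⟨b * m, ?_⟩
    have hc : c = algebraMap F K a * kn + algebraMap F K b * (ε * kn) := by
      rw [← mul_assoc, ← add_mul, ← hab]; field_simp
    have e : ((0, c • w) : F × (K × K)) = a • (0, kn • w) + b • (0, (ε * kn) • w) := by
      rw [hc, add_smul, mul_smul, mul_smul]
      simp
    rw [e, map_add, map_smul, map_smul, hΨn, smul_zero, zero_add, map_smul, hm]
    ext i; fin_cases i <;> simp
  have hsurj' : ∀ x, ∃ v, h (Ψ v) = x := hh.1.comp hsurj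
  obtain ⟨v0, hv0⟩ := hsurj' ![1, 0, 0, 0]
  obtain ⟨v1, hv1⟩ := hsurj' ![0, 1, 0, 0]
  obtain ⟨v2, hv2⟩ := hsurj' ![0, 0, 1, 0]
  -- The first coordinate vanishes at the vertex, so it factors through the projection. No x₃ term
  -- appears because (0,0,0,1) is the image of a vector at infinity.
  have hfun : ∀ v, v.1 = v0.1 * h (Ψ v) 0 + v1.1 * h (Ψ v) 1 + v2.1 * h (Ψ v) 2 := fun v => by
    obtain ⟨c, hc⟩ := (hker (v - (h (Ψ v) 0 • v0 + h (Ψ v) 1 • v1 + h (Ψ v) 2 • v2 +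
        (h (Ψ v) 3 * m⁻¹) • (0, (ε * kn) • w)))).1 <| hinj <| by
      simp only [map_sub, map_add, map_smul, hv0, hv1, hv2, hm, map_zero]
      ext i; fin_cases i <;> simp [hm0]
    have := (Prod.ext_iff.1 hc).1
    simp at this
    linear_combination this
  -- A nonzero coefficient would give the plane at infinity an affine ovoid point, which cannot come
  -- from the spread element. So the plane is x₀ = 0, and scaling by `v0.1` normalises the equation.
  have h12 : v1.1 = 0 ∧ v2.1 = 0 := by
    by_contra hcon
    obtain ⟨s, t, hst⟩ : ∃ s t : F, v0.1 + v1.1 * s + v2.1 * t = 0 := by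
      by_cases h1 : v1.1 = 0
      · have h2 : v2.1 ≠ 0 := fun h2 => hcon ⟨h1, h2⟩
        exact ⟨0, -v0.1 / v2.1, by field_simp; ring⟩
      · exact ⟨-v0.1 / v1.1, 0, by field_simp; ring⟩
    obtain ⟨v, hv⟩ := hsurj' ![1, s, t, titsForm σ s t]
    have hvz : v.1 = 0 := by rw [hfun, hv, ← hst]; simp
    obtain ⟨c, rfl⟩ := (hsp v).1 ⟨hvz, (hh.2 _).1 (hv ▸ isTitsVec_affine_iff.2 rfl)⟩
    obtain ⟨m', hm'⟩ := hvert c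
    rw [hm'] at hv
    simpa using congrFun hv 0
  rw [h12.1, h12.2] at hfun
  simp only [zero_mul, add_zero] at hfun
  have hl0 : v0.1 ≠ 0 := fun hl0 => by simpa [hl0] using hfun (1, 0)
  have hA := (isTitsAut_smul (σ := σ) hl0).comp hh
  refine ⟨((v0.1 • LinearMap.id) ∘ₗ h) ∘ₗ Ψ, ⟨hA.1.comp hsurj, fun v => ?_, hw, fun k => ?_⟩,
    fun v => hA.2 _⟩
  · simp [← hfun]
  · simp only [LinearMap.comp_apply, LinearMap.smul_apply, LinearMap.id_apply, Pi.smul_apply,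
      smul_eq_mul, mul_eq_zero, hl0, false_or]
    constructor
    · rintro ⟨e1, e2⟩
      have e0 : h (Ψ (0, k)) 0 = 0 := by simpa [hl0] using hfun (0, k)
      have hT : IsTitsVec σ (h (Ψ (0, k))) := by
        rw [vec4_ext e0 e1 e2 rfl]; exact isTitsVec_vert _
      obtain ⟨c, hc⟩ := (hsp (0, k)).1 ⟨rfl, (hh.2 _).1 hT⟩
      exact ⟨c, (Prod.ext_iff.1 hc).2⟩
    · rintro ⟨c, rfl⟩
      obtain ⟨m', hm'⟩ := hvert c
      simp [hm']

variable {Ψ : F × (K × K) →ₗ[F] (Fin 4 → F)} {w : K × K}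

theorem IsConeProj.comp (hΨ : IsConeProj Ψ w) {h : (Fin 4 → F) →ₗ[F] (Fin 4 → F)}
    (hs : Function.Surjective h) (h0 : ∀ x, h x 0 = x 0)
    (h12 : ∀ x, x 0 = 0 → ((h x 1 = 0 ∧ h x 2 = 0) ↔ (x 1 = 0 ∧ x 2 = 0))) :
    IsConeProj (h ∘ₗ Ψ) w :=
  ⟨hs.comp hΨ.surj, fun v => (h0 _).trans (hΨ.apply_zero v), hΨ.ne_zero, fun k =>
    (h12 _ (hΨ.apply_zero _)).trans (hΨ.spread k)⟩

theorem IsConeProj.exists_infinite (hΨ : IsConeProj Ψ w) (x y z : F) :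
    ∃ a : K × K, Ψ (0, a) = ![0, x, y, z] := by
  obtain ⟨⟨v, a⟩, hv⟩ := hΨ.surj ![0, x, y, z]
  have : v = 0 := by
    have := hΨ.apply_zero (v, a)
    rw [hv] at this
    simpa using this.symm
  exact ⟨a, this ▸ hv⟩

theorem IsConeProj.add_smul_apply (Ψ : F × (K × K) →ₗ[F] (Fin 4 → F)) (s t : F) (a : K × K)
    (k : K) : Ψ (0, (algebraMap F K s + algebraMap F K t * k) • a) =
      s • Ψ (0, a) + t • Ψ (0, k • a) := by
  rw [← map_smul, ← map_smul, ← map_add]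
  congr 1
  simp [add_smul, mul_smul]

/-- Coordinates of `PG(2, q²)` in which the cone is in standard position. -/
theorem IsConeProj.exists_frame (hΨ : IsConeProj Ψ w) (h2 : Module.finrank F K = 2)
    {ε : K} (hε : ε ∉ Set.range (algebraMap F K)) {a : K × K}
    (ha1 : Ψ (0, a) 1 = 1) (ha2 : Ψ (0, a) 2 = 0) (hb1 : Ψ (0, ε • a) 1 = 0)
    (hb2 : Ψ (0, ε • a) 2 = 1) :
    ∃ (a' : K × K) (κ : K), κ ≠ 0 ∧ ∀ s t r m : F,
      Ψ (0, (algebraMap F K s + algebraMap F K t * ε) • a' +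
        (algebraMap F K r + algebraMap F K m * ε) • κ • w) = ![0, s, t, m] := by
  have hvert : ∀ c : K, Ψ (0, c • w) = ![0, 0, 0, Ψ (0, c • w) 3] := fun c =>
    vec4_ext (hΨ.apply_zero _) ((hΨ.spread _).2 ⟨c, rfl⟩).1 ((hΨ.spread _).2 ⟨c, rfl⟩).2 rfl
  obtain ⟨n, hn0, hn⟩ : ∃ n : K, n ≠ 0 ∧ Ψ (0, n • w) = 0 := by
    by_cases h1 : Ψ (0, (1 : K) • w) 3 = 0
    · refine ⟨1, one_ne_zero, ?_⟩
      rw [hvert, h1]; ext i; fin_cases i <;> rfl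
    · refine ⟨algebraMap F K (-(Ψ (0, ε • w) 3 / Ψ (0, (1 : K) • w) 3)) +
        algebraMap F K 1 * ε, fun h => one_ne_zero (rep_eq_zero hε h).2, ?_⟩
      rw [IsConeProj.add_smul_apply, hvert ε]
      rw [one_smul] at h1 ⊢
      have := hvert 1
      rw [one_smul] at this
      rw [this]
      ext i; fin_cases i <;> simp [h1]
  have hεn : Ψ (0, (ε * n) • w) 3 ≠ 0 := fun h => by
    have hz : Ψ (0, (ε * n) • w) = 0 := by
      rw [hvert, h]; ext i; fin_cases i <;> rfl
    obtain ⟨u, hu⟩ := hΨ.exists_infinite 0 0 1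
    obtain ⟨c, rfl⟩ := (hΨ.spread u).1 (by simp [hu])
    obtain ⟨x, y, hxy⟩ := exists_rep h2 hε (c / n)
    have hc : c • w = (algebraMap F K x + algebraMap F K y * ε) • n • w := by
      rw [← hxy, smul_smul]; congr 1; field_simp
    rw [hc, IsConeProj.add_smul_apply, smul_smul, hz, hn] at hu
    simpa using congrFun hu 3
  set l := Ψ (0, (ε * n) • w) 3 with hl
  -- κw represents the vertex, scaled so that εκw maps to exactly (0,0,0,1).
  obtain ⟨κ, hκdef⟩ : ∃ κ, κ = algebraMap F K l⁻¹ * n := ⟨_, rfl⟩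
  have hκ0 : κ ≠ 0 := by rw [hκdef]; simp [hεn, hn0]
  have hκ : Ψ (0, κ • w) = 0 := by
    have : ((0, κ • w) : F × (K × K)) = l⁻¹ • (0, n • w) := by
      rw [hκdef, mul_smul, algebraMap_smul]; simp
    rw [this, map_smul, hn, smul_zero]
  have hεκ : Ψ (0, ε • κ • w) = ![0, 0, 0, 1] := by
    have : ((0, ε • κ • w) : F × (K × K)) = l⁻¹ • (0, (ε * n) • w) := by
      rw [hκdef, smul_smul, mul_left_comm, mul_smul, algebraMap_smul]; simp
    rw [this, map_smul, hvert, ← hl]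
    ext i; fin_cases i <;> simp [hεn]
  set d := Ψ (0, ε • a) 3 with hd
  set d' := Ψ (0, a) 3 with hd'
  have hA : Ψ (0, a) = ![0, 1, 0, d'] := vec4_ext (hΨ.apply_zero _) ha1 ha2 rfl
  have hB : Ψ (0, ε • a) = ![0, 0, 1, d] := vec4_ext (hΨ.apply_zero _) hb1 hb2 rfl
  -- Adding δκw to a must cancel the last coordinates over both a and εa. These prescribe the
  -- ε-components of δ and εδ, which determine δ.
  obtain ⟨δ, hδ1, hδ2⟩ : ∃ δ : K, Ψ (0, δ • κ • w) = ![0, 0, 0, -d'] ∧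
      Ψ (0, (ε * δ) • κ • w) = ![0, 0, 0, -d] := by
    obtain ⟨D, T, hε2⟩ := exists_rep h2 hε (ε * ε)
    have hgen : ∀ r m : F, Ψ (0, (algebraMap F K r + algebraMap F K m * ε) • κ • w) =
        ![0, 0, 0, m] := fun r m => by
      rw [IsConeProj.add_smul_apply, hκ, hεκ]; ext i; fin_cases i <;> simp
    refine ⟨algebraMap F K (-d + d' * T) + algebraMap F K (-d') * ε, hgen _ _, ?_⟩
    have : ε * (algebraMap F K (-d + d' * T) + algebraMap F K (-d') * ε) =
        algebraMap F K (-d' * D) + algebraMap F K (-d) * ε := by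
      simp only [map_add, map_neg, map_mul]
      linear_combination (-algebraMap F K d') * hε2
    rw [this, hgen]
  refine ⟨a + δ • κ • w, κ, hκ0, fun s t r m => ?_⟩
  have hA' : Ψ (0, a + δ • κ • w) = ![0, 1, 0, 0] := by
    have : ((0, a + δ • κ • w) : F × (K × K)) = (0, a) + (0, δ • κ • w) := by simp
    rw [this, map_add, hA, hδ1]; ext i; fin_cases i <;> simp
  have hB' : Ψ (0, ε • (a + δ • κ • w)) = ![0, 0, 1, 0] := by
    have : ((0, ε • (a + δ • κ • w)) : F × (K × K)) =
      (0, ε • a) + (0, (ε * δ) • κ • w) := by simp [mul_smul]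
    rw [this, map_add, hB, hδ2]; ext i; fin_cases i <;> simp
  have hsplit : ∀ x y : K × K, Ψ (0, x + y) = Ψ (0, x) + Ψ (0, y) := fun x y => by
    rw [← map_add]; simp
  rw [hsplit, IsConeProj.add_smul_apply, IsConeProj.add_smul_apply, hA', hB', hκ, hεκ]
  ext i; fin_cases i <;> simp

end Projection

theorem one_pair_ne_zero {F M : Type*} [Field F] [AddCommGroup M] (k : M) : ((1, k) : F × M) ≠ 0 :=
  fun h => one_ne_zero (Prod.ext_iff.1 h).1

/-! ### Coordinates for the plane, the slope ε, and the choice of point. -/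

section Coordinates

variable {F K : Type*} [Field F] [Field K] [Algebra F K] {σ : F ≃+* F}
  {Ψ : F × (K × K) →ₗ[F] (Fin 4 → F)} {w : K × K}

theorem abbPoint_mk (v : F × (K × K)) (hv : v ≠ 0) (hv' : abbMap F K v ≠ 0) :
    abbPoint F K (Projectivization.mk F v hv) = Projectivization.mk K (abbMap F K v) hv' := rfl

theorem abbMap_ne_zero {v : F × (K × K)} (hv : v ≠ 0) : abbMap F K v ≠ 0 := fun h =>
  hv (abbMap_injective F K (h.trans (map_zero _).symm))

theorem abbPoint_affine (k : K × K) :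
    abbPoint F K (Projectivization.mk F (1, k) (one_pair_ne_zero k)) = affPt k.1 k.2 := by
  rw [abbPoint_mk _ _ (abbMap_ne_zero (one_pair_ne_zero k)), affPt]
  congr 1
  simp [abbMap]

theorem mk_eq_affine {v : F × (K × K)} (hv : v ≠ 0) (h : v.1 ≠ 0) :
    Projectivization.mk F v hv = Projectivization.mk F (1, v.1⁻¹ • v.2) (one_pair_ne_zero _) := by
  rw [Projectivization.mk_eq_mk_iff']
  exact ⟨v.1, Prod.ext (by simp) (by simp [smul_smul, h])⟩

theorem IsConeProj.exists_coords (hΨ : IsConeProj Ψ w) (h2 : Module.finrank F K = 2)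
    {ε : K} (hε : ε ∉ Set.range (algebraMap F K)) {a : K × K}
    (ha1 : Ψ (0, a) 1 = 1) (ha2 : Ψ (0, a) 2 = 0) (hb1 : Ψ (0, ε • a) 1 = 0)
    (hb2 : Ψ (0, ε • a) 2 = 1) {k : K × K} (hk : Ψ (1, k) = ![1, 1, 0, 0])
    {C : Set (ℙ F (F × (K × K)))}
    (hC : ∀ v hv, Projectivization.mk F v hv ∈ C ↔ IsTitsVec σ (Ψ v)) :
    ∃ g : (Fin 3 → K) ≃ₗ[K] (Fin 3 → K), (∀ x, g x 0 = x 0) ∧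
      abbPoint F K '' C =
        Projectivization.map g.toLinearMap g.injective '' stdUnital σ ε ∧
      Projectivization.map g.toLinearMap g.injective (affPt 1 0) = affPt k.1 k.2 := by
  obtain ⟨a', κ, hκ, hfr⟩ := hΨ.exists_frame h2 hε ha1 ha2 hb1 hb2
  set w' := κ • w with hw'
  -- The offset k − a' makes (1,1,0) correspond to the affine point k.
  let g0 : (Fin 3 → K) →ₗ[K] (Fin 3 → K) :=
    { toFun := fun x => ![x 0, (x 0 • (k - a') + x 1 • a' + x 2 • w').1,
        (x 0 • (k - a') + x 1 • a' + x 2 • w').2]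
      map_add' := fun x y => by ext i; fin_cases i <;> simp <;> ring
      map_smul' := fun c x => by ext i; fin_cases i <;> simp <;> ring }
  have hg0 : ∀ x, g0 x = ![x 0, (x 0 • (k - a') + x 1 • a' + x 2 • w').1,
        (x 0 • (k - a') + x 1 • a' + x 2 • w').2] := fun _ => rfl
  have hinj : Function.Injective g0 := by
    rw [← LinearMap.ker_eq_bot, LinearMap.ker_eq_bot']
    intro x hx
    rw [hg0] at hx
    have h0 : x 0 = 0 := congrFun hx 0
    have h1 : x 1 • a' + x 2 • w' = 0 := by
      have e1 := congrFun hx 1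
      have e2 := congrFun hx 2
      simp only [h0, zero_smul, zero_add] at e1 e2
      exact Prod.ext e1 e2
    obtain ⟨s, t, hst⟩ := exists_rep h2 hε (x 1)
    obtain ⟨r, m, hrm⟩ := exists_rep h2 hε (x 2)
    have h3 := hfr s t r m
    rw [← hst, ← hrm, h1] at h3
    have hz : Ψ (0, 0) = 0 := map_zero Ψ
    rw [hz] at h3
    have hs : s = 0 := (congrFun h3 1).symm
    have ht : t = 0 := (congrFun h3 2).symm
    have hx1 : x 1 = 0 := by rw [hst, hs, ht]; simp
    rw [hx1, zero_smul, zero_add] at h1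
    have hx2 : x 2 = 0 := (smul_eq_zero.1 h1).resolve_right (smul_ne_zero hκ hΨ.ne_zero)
    ext i; fin_cases i <;> assumption
  let g := LinearEquiv.ofInjectiveEndo g0 hinj
  have hg : ∀ x, g x = ![x 0, (x 0 • (k - a') + x 1 • a' + x 2 • w').1,
        (x 0 • (k - a') + x 1 • a' + x 2 • w').2] := fun _ => rfl
  have hA : Ψ (0, a') = ![0, 1, 0, 0] := by simpa using hfr 1 0 0 0
  have hval : ∀ s t r m : F, Ψ (1, (k - a') + (algebraMap F K s + algebraMap F K t * ε) • a' +
      (algebraMap F K r + algebraMap F K m * ε) • w') = ![1, s, t, m] := fun s t r m => by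
    have : ((1, (k - a') + (algebraMap F K s + algebraMap F K t * ε) • a' +
      (algebraMap F K r + algebraMap F K m * ε) • w') : F × (K × K)) = (1, k) - (0, a') +
      (0, (algebraMap F K s + algebraMap F K t * ε) • a' +
      (algebraMap F K r + algebraMap F K m * ε) • w') := by
        simp [add_assoc]
    rw [this, map_add, map_sub, hk, hA, hfr]
    ext i; fin_cases i <;> simp
  have hmap : ∀ y z, Projectivization.map g.toLinearMap g.injective (affPt y z) =
      affPt ((k - a') + y • a' + z • w').1 ((k - a') + y • a' + z • w').2 := fun y z => by
    rw [affPt, Projectivization.map_mk, affPt]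
    congr 1
    rw [LinearEquiv.coe_coe, hg]
    simp
  have hw'0 : ((0, w') : F × (K × K)) ≠ 0 := fun h =>
    smul_ne_zero hκ hΨ.ne_zero (Prod.ext_iff.1 h).2
  have hvert : Projectivization.map g.toLinearMap g.injective (vertPt K) =
      abbPoint F K (Projectivization.mk F (0, w') hw'0) := by
    rw [vertPt, Projectivization.map_mk, abbPoint_mk _ _ (abbMap_ne_zero hw'0)]
    congr 1
    rw [LinearEquiv.coe_coe, hg]
    simp [abbMap]
  refine ⟨g, fun x => rfl, ?_, ?_⟩
  · apply Set.Subset.antisymm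
    · rintro _ ⟨P, hP, rfl⟩
      induction P using Projectivization.ind with
      | h v hv =>
      rw [hC] at hP
      by_cases h0 : v.1 = 0
      · obtain ⟨c, hc⟩ := (hΨ.spread v.2).1 (by
          have : ((0, v.2) : F × (K × K)) = v := Prod.ext h0.symm rfl
          rw [this]
          exact hP.of_apply_zero ((hΨ.apply_zero v).trans h0))
        refine ⟨vertPt K, .inl rfl, ?_⟩
        rw [hvert, abbPoint_mk _ _ (abbMap_ne_zero hw'0), abbPoint_mk _ _ (abbMap_ne_zero hv),
          eq_comm, Projectivization.mk_eq_mk_iff']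
        refine ⟨c / κ, ?_⟩
        have : v = (0, c • w) := Prod.ext h0 hc
        rw [this]
        ext i; fin_cases i <;> simp [abbMap, hw'] <;> field_simp
      · have hT : IsTitsVec σ (Ψ (1, v.1⁻¹ • v.2)) := by
          have : ((1, v.1⁻¹ • v.2) : F × (K × K)) = v.1⁻¹ • v := Prod.ext (by simp [h0]) rfl
          rw [this, map_smul]
          exact hP.smul _
        rw [mk_eq_affine hv h0, abbPoint_affine]
        generalize v.1⁻¹ • v.2 = k' at hT
        obtain ⟨x, hx⟩ := g.surjective ![1, k'.1, k'.2]
        rw [hg] at hx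
        have hx0 : x 0 = 1 := congrFun hx 0
        have e1 := congrFun hx 1
        have e2 := congrFun hx 2
        obtain ⟨s, t, hst⟩ := exists_rep h2 hε (x 1)
        obtain ⟨r, m, hrm⟩ := exists_rep h2 hε (x 2)
        simp only [hx0, one_smul, hst, hrm] at e1 e2
        have hk' := Prod.ext (y := k') e1 e2
        rw [← hk', hval, isTitsVec_affine_iff] at hT
        refine ⟨_, .inr ⟨s, t, r, rfl⟩, ?_⟩
        rw [hmap, ← hT, hk']
    · rintro _ ⟨P, hP | ⟨s, t, r, rfl⟩, rfl⟩
      · rw [hP, hvert]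
        refine ⟨_, (hC _ _).2 ?_, rfl⟩
        have := (hΨ.spread w').2 ⟨κ, rfl⟩
        rw [vec4_ext (hΨ.apply_zero _) this.1 this.2 rfl]
        exact isTitsVec_vert _
      · rw [hmap]
        refine ⟨_, (hC _ _).2 ?_, abbPoint_affine _⟩
        rw [hval]
        exact isTitsVec_affine_iff.2 rfl
  · rw [hmap]
    simp

theorem IsConeProj.diag (hσ : ∀ x, σ (σ x) = x ^ 2) (hΨ : IsConeProj Ψ w) {l : F} (hl : l ≠ 0) :
    IsConeProj (titsDiag σ l ∘ₗ Ψ) w :=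
  hΨ.comp (isTitsAut_diag hσ hl).1 (fun x => rfl) fun x _ => by
    simp [titsDiag_apply, hl]

theorem IsConeProj.transl [CharP F 2] (hσ : ∀ x, σ (σ x) = x ^ 2) (hΨ : IsConeProj Ψ w) (a b : F) :
    IsConeProj (titsTransl σ a b ∘ₗ Ψ) w :=
  hΨ.comp (isTitsAut_transl hσ a b).1 (fun x => rfl) fun x h0 => by
    simp only [titsTransl_apply, Matrix.cons_val, h0]
    constructor
    · rintro ⟨h1, h2⟩
      have h1' : x 1 = 0 := by simpa using h1
      exact ⟨h1', by simpa [h1'] using h2⟩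
    · rintro ⟨h1, h2⟩
      simp [h1, h2]

/-- Modulo Kw the space K² is one-dimensional over K, so lifts a, b of the second and third basis
vectors satisfy b ≡ εa. Their images are independent over F, so ε is not in F. -/
theorem IsConeProj.exists_slope (hΨ : IsConeProj Ψ w) :
    ∃ (ε : K) (a : K × K), ε ∉ Set.range (algebraMap F K) ∧ Ψ (0, a) 1 = 1 ∧ Ψ (0, a) 2 = 0 ∧
      Ψ (0, ε • a) 1 = 0 ∧ Ψ (0, ε • a) 2 = 1 := by
  obtain ⟨a, ha⟩ := hΨ.exists_infinite 1 0 0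
  obtain ⟨b, hb⟩ := hΨ.exists_infinite 0 1 0
  have haw : ∀ c : K, a ≠ c • w := fun c h => by
    have := (hΨ.spread a).2 ⟨c, h⟩
    simp [ha] at this
  have hdet : a.1 * w.2 - a.2 * w.1 ≠ 0 := fun h => by
    by_cases hw1 : w.1 = 0
    · have hw2 : w.2 ≠ 0 := fun hw2 => hΨ.ne_zero (Prod.ext hw1 hw2)
      have ha1 : a.1 = 0 := by simpa [hw1, hw2] using h
      exact haw (a.2 / w.2) (Prod.ext (by simp [hw1, ha1]) (by simp [hw2]))
    · refine haw (a.1 / w.1) (Prod.ext (by simp [hw1]) ?_)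
      simp only [Prod.smul_snd, smul_eq_mul]
      field_simp
      linear_combination -h
  obtain ⟨ε, κ, hεκ⟩ : ∃ ε κ : K, b = ε • a + κ • w := by
    refine ⟨(b.1 * w.2 - b.2 * w.1) / (a.1 * w.2 - a.2 * w.1),
      (a.1 * b.2 - a.2 * b.1) / (a.1 * w.2 - a.2 * w.1), Prod.ext ?_ ?_⟩
    · simp only [Prod.fst_add, Prod.smul_fst, smul_eq_mul]
      rw [div_mul_eq_mul_div, div_mul_eq_mul_div, ← add_div, eq_div_iff hdet]
      ring
    · simp only [Prod.snd_add, Prod.smul_snd, smul_eq_mul]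
      rw [div_mul_eq_mul_div, div_mul_eq_mul_div, ← add_div, eq_div_iff hdet]
      ring
  have hκ := (hΨ.spread (κ • w)).2 ⟨κ, rfl⟩
  have hεa : Ψ (0, ε • a) = Ψ (0, b) - Ψ (0, κ • w) := by
    rw [← map_sub, hεκ]; simp
  have h1 : Ψ (0, ε • a) 1 = 0 := by rw [hεa, Pi.sub_apply, hκ.1, hb]; simp
  have h2 : Ψ (0, ε • a) 2 = 1 := by rw [hεa, Pi.sub_apply, hκ.2, hb]; simp
  refine ⟨ε, a, ?_, by simp [ha], by simp [ha], h1, h2⟩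
  rintro ⟨c, rfl⟩
  have : ((0, algebraMap F K c • a) : F × (K × K)) = c • (0, a) := by simp
  rw [this, map_smul, ha] at h2
  simp at h2

/-- Every `ε` outside the base field is the slope of the cone for suitable coordinates. -/
theorem IsConeProj.exists_isTitsAut_slope [CharP F 2] (hσ : ∀ x, σ (σ x) = x ^ 2)
    (hΨ : IsConeProj Ψ w) {ε : K} (hε : ε ∉ Set.range (algebraMap F K)) :
    ∃ h, IsTitsAut σ h ∧ IsConeProj (h ∘ₗ Ψ) w ∧ ∃ a : K × K, h (Ψ (0, a)) 1 = 1 ∧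
      h (Ψ (0, a)) 2 = 0 ∧ h (Ψ (0, ε • a)) 1 = 0 ∧ h (Ψ (0, ε • a)) 2 = 1 := by
  have hε0 : ε ≠ 0 := by rintro rfl; exact hε ⟨0, map_zero _⟩
  obtain ⟨b, hb⟩ := hΨ.exists_infinite 0 1 0
  obtain ⟨X, hX⟩ : ∃ X, X = Ψ (0, ε⁻¹ • b) 1 := ⟨_, rfl⟩
  obtain ⟨Y, hY⟩ : ∃ Y, Y = Ψ (0, ε⁻¹ • b) 2 := ⟨_, rfl⟩
  -- X = 0 would make ε⁻¹b an F-multiple of b modulo Kw, forcing ε into F.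
  have hX0 : X ≠ 0 := by
    rintro hX0
    have hd : ∀ c : F, Ψ (0, ε⁻¹ • b - algebraMap F K c • b) =
        Ψ (0, ε⁻¹ • b) - c • Ψ (0, b) := fun c => by
      rw [← map_smul, ← map_sub]; simp
    obtain ⟨c, hc⟩ := (hΨ.spread (ε⁻¹ • b - algebraMap F K Y • b)).1 (by
      rw [hd, hb]; simp [← hX, ← hY, hX0])
    have hne : ε⁻¹ - algebraMap F K Y ≠ 0 := fun h => hε ⟨Y⁻¹, by
      rw [map_inv₀, ← sub_eq_zero.1 h, inv_inv]⟩
    have := (hΨ.spread b).2 ⟨c / (ε⁻¹ - algebraMap F K Y), by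
      rw [div_eq_inv_mul, mul_smul, ← hc, ← sub_smul, smul_smul, inv_mul_cancel₀ hne, one_smul]⟩
    simp [hb] at this
  obtain ⟨l, hl⟩ : ∃ l, l = σ.symm X := ⟨_, rfl⟩
  have hlX : σ l = X := by rw [hl, RingEquiv.apply_symm_apply]
  have hl0 : l ≠ 0 := by rintro rfl; exact hX0 (by rw [← hlX, map_zero])
  -- The translation by α clears Y in the image of ε⁻¹b. The diagonal map with σ(l) = X then scales
  -- both images by the same factor lX, removed by rescaling b.
  obtain ⟨α, hα⟩ : ∃ α, σ α = Y / X := ⟨σ.symm (Y / X), RingEquiv.apply_symm_apply _ _⟩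
  refine ⟨titsDiag σ l ∘ₗ titsTransl σ α 0, (isTitsAut_diag hσ hl0).comp (isTitsAut_transl hσ α 0),
    (hΨ.transl hσ α 0).diag hσ hl0, algebraMap F K (l * X)⁻¹ • ε⁻¹ • b, ?_⟩
  have h1 : ((0, algebraMap F K (l * X)⁻¹ • ε⁻¹ • b) : F × (K × K)) =
      (l * X)⁻¹ • (0, ε⁻¹ • b) := by
    rw [algebraMap_smul]; simp
  have h2 : ((0, ε • algebraMap F K (l * X)⁻¹ • ε⁻¹ • b) : F × (K × K)) =
      (l * X)⁻¹ • (0, b) := by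
    rw [smul_comm ε, smul_smul ε, mul_inv_cancel₀ hε0, one_smul, algebraMap_smul]; simp
  have hz : Ψ (0, ε⁻¹ • b) 0 = 0 := hΨ.apply_zero _
  have h2F : (2 : F) = 0 := CharTwo.two_eq_zero
  rw [h1, h2, map_smul, map_smul, map_smul, map_smul, hb]
  simp only [LinearMap.comp_apply, titsDiag_apply, titsTransl_apply, Pi.smul_apply, smul_eq_mul,
    Matrix.cons_val, hz, ← hX, ← hY, hα, hlX]
  refine ⟨?_, ?_, ?_, ?_⟩
  · field_simp; ring
  · field_simp
    linear_combination Y * h2F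
  · ring
  · field_simp; ring

/-- The collineations of the Tits ovoid fixing `(0, 0, 0, 1)` are transitive on the points off
the ovoid and off the tangent plane at that point. -/
theorem IsConeProj.exists_isTitsAut_point [CharP F 2] (hσ : ∀ x, σ (σ x) = x ^ 2)
    (hΨ : IsConeProj Ψ w) {k : K × K} (hk : ¬ IsTitsVec σ (Ψ (1, k))) :
    ∃ h, IsTitsAut σ h ∧ IsConeProj (h ∘ₗ Ψ) w ∧ h (Ψ (1, k)) = ![1, 1, 0, 0] := by
  obtain ⟨x, hx⟩ : ∃ x, x = Ψ (1, k) 1 := ⟨_, rfl⟩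
  obtain ⟨y, hy⟩ : ∃ y, y = Ψ (1, k) 2 := ⟨_, rfl⟩
  obtain ⟨z, hz⟩ : ∃ z, z = Ψ (1, k) 3 := ⟨_, rfl⟩
  have hΨk : Ψ (1, k) = ![1, x, y, z] := vec4_ext (hΨ.apply_zero _) hx.symm hy.symm hz.symm
  rw [hΨk, isTitsVec_affine_iff] at hk
  -- The quantity z + f(x,y) measures how far the point is from the ovoid. Translating to (p, 0, 0)
  -- needs f(p, 0) equal to it, and the diagonal map for p⁻¹ then gives (1, 0, 0).
  obtain ⟨p, hp, hpd⟩ := exists_pow_sigma_add_two hσ (c := z + titsForm σ x y)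
    (fun h => hk (by grind))
  have hp' : σ p ≠ 0 := by simpa using hp
  refine ⟨titsDiag σ p⁻¹ ∘ₗ titsTransl σ (p + x) (y + σ (p + x) * x),
    (isTitsAut_diag hσ (inv_ne_zero hp)).comp (isTitsAut_transl hσ _ _),
    (hΨ.transl hσ _ _).diag hσ (inv_ne_zero hp), ?_⟩
  have e1 : x + (p + x) = p := by grind
  have e2 : y + (y + σ (p + x) * x) + σ (p + x) * x = 0 := by grind
  have h3 := titsForm_translate hσ (p + x) (y + σ (p + x) * x) x y
  rw [e1, e2] at h3
  have h4 : titsForm σ p 0 = z + titsForm σ x y := by rw [← hpd]; simp [titsForm]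
  rw [hΨk, LinearMap.comp_apply, titsTransl_apply, titsDiag_apply]
  refine vec4_ext ?_ ?_ ?_ ?_ <;> simp only [Matrix.cons_val]
  · rw [mul_one, e1, inv_mul_cancel₀ hp]
  · rw [mul_one, e2, mul_zero]
  · have : z + (y + σ (p + x) * x + σ (p + x) * (p + x)) * x + (p + x) * y +
        titsForm σ (p + x) (y + σ (p + x) * x) = 0 := by grind
    rw [mul_one, this, mul_zero]

end Coordinates

/-! ### Invariance of lines and feet under collineations. -/

section Transport

variable {k V : Type*} [Field k] [AddCommGroup V] [Module k V] (g : V ≃ₗ[k] V)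

theorem map_equiv_injective :
    Function.Injective (Projectivization.map g.toLinearMap g.injective) :=
  Projectivization.map_injective _ _

theorem map_equiv_map_symm (P : ℙ k V) :
    Projectivization.map g.toLinearMap g.injective
      (Projectivization.map g.symm.toLinearMap g.symm.injective P) = P := by
  induction P using Projectivization.ind with
  | h v hv =>
  rw [Projectivization.map_mk, Projectivization.map_mk]
  congr 1
  simp

theorem image_subspacePoints (W : Submodule k V) :
    Projectivization.map g.toLinearMap g.injective '' subspacePoints W =
      subspacePoints (W.map g.toLinearMap) := by
  have key : ∀ P, Projectivization.map g.toLinearMap g.injective P ∈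
      subspacePoints (W.map g.toLinearMap) ↔ P ∈ subspacePoints W := fun P => by
    induction P using Projectivization.ind with
    | h v hv =>
    rw [Projectivization.map_mk, mk_mem_subspacePoints, mk_mem_subspacePoints]
    simp
  ext P
  constructor
  · rintro ⟨Q, hQ, rfl⟩
    exact (key Q).2 hQ
  · intro hP
    rw [← map_equiv_map_symm g P, key] at hP
    exact ⟨_, hP, map_equiv_map_symm g P⟩

theorem isLine_image {l : Set (ℙ k V)} (hl : IsLine l) :
    IsLine (Projectivization.map g.toLinearMap g.injective '' l) := by
  obtain ⟨W, hW, rfl⟩ := hl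
  exact ⟨_, (LinearEquiv.finrank_map_eq g W).trans hW, image_subspacePoints g W⟩

theorem exists_eq_image_of_isLine {l : Set (ℙ k V)} (hl : IsLine l) :
    ∃ l', IsLine l' ∧ l = Projectivization.map g.toLinearMap g.injective '' l' := by
  refine ⟨_, isLine_image g.symm hl, ?_⟩
  rw [Set.image_image]
  simp only [map_equiv_map_symm, Set.image_id']

theorem feet_image (U : Set (ℙ k V)) (P : ℙ k V) :
    feet (Projectivization.map g.toLinearMap g.injective '' U)
      (Projectivization.map g.toLinearMap g.injective P) =
    Projectivization.map g.toLinearMap g.injective '' feet U P := by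
  have hinj := map_equiv_injective g
  ext Q
  constructor
  · rintro ⟨l, hl, hP, hlU⟩
    obtain ⟨l', hl', rfl⟩ := exists_eq_image_of_isLine g hl
    rw [← Set.image_inter hinj] at hlU
    obtain ⟨Q', hQ', rfl⟩ : Q ∈ Projectivization.map g.toLinearMap g.injective '' (l' ∩ U) :=
      hlU ▸ rfl
    rw [← Set.image_singleton, (Set.image_injective.2 hinj).eq_iff] at hlU
    exact ⟨Q', ⟨l', hl', (hinj.mem_set_image).1 hP, hlU⟩, rfl⟩
  · rintro ⟨Q, ⟨l, hl, hP, hlU⟩, rfl⟩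
    refine ⟨_, isLine_image g hl, Set.mem_image_of_mem _ hP, ?_⟩
    rw [← Set.image_inter hinj, hlU, Set.image_singleton]

theorem ncard_image_inter_feet (U l : Set (ℙ k V)) (P : ℙ k V) :
    (Projectivization.map g.toLinearMap g.injective '' l ∩
      feet (Projectivization.map g.toLinearMap g.injective '' U)
        (Projectivization.map g.toLinearMap g.injective P)).ncard = (l ∩ feet U P).ncard := by
  have hinj := map_equiv_injective g
  rw [feet_image, ← Set.image_inter hinj, Set.ncard_image_of_injective _ hinj]

theorem map_trans_image (g' : V ≃ₗ[k] V) (S : Set (ℙ k V)) :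
    Projectivization.map (g.trans g').toLinearMap (g.trans g').injective '' S =
      Projectivization.map g'.toLinearMap g'.injective ''
        (Projectivization.map g.toLinearMap g.injective '' S) := by
  rw [Set.image_image]
  refine Set.image_congr fun P _ => ?_
  induction P using Projectivization.ind with
  | h v hv => rfl

end Transport

/-! ### Reduction of an arbitrary unital to standard position, and the counts. -/

section Unital

variable {F K : Type*} [Field F] [Field K] [Algebra F K]

theorem mem_spreadElement {w : K × K} {v : F × (K × K)} :
    v ∈ spreadElement F w ↔ ∃ c : K, v = (0, c • w) := by
  simp [spreadElement, eq_comm]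

/-- X² + X + D has no root in F, so it is irreducible, and its degree-two root field embeds in the
finite field K. -/
theorem exists_quadratic_root [Finite K] (h2 : Module.finrank F K = 2) {D : F}
    (hD : ∀ g : F, g ^ 2 + g ≠ D) [CharP F 2] :
    ∃ ε : K, ε ∉ Set.range (algebraMap F K) ∧ ε ^ 2 = ε + algebraMap F K D := by
  have hchar : CharP K 2 := charP_of_injective_algebraMap (algebraMap F K).injective 2
  open Polynomial in
  obtain ⟨p, hp⟩ : ∃ p : F[X], p = X ^ 2 + X + C D := ⟨_, rfl⟩
  have hdeg : p.natDegree = 2 := by rw [hp]; compute_degree!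
  have hirr : Irreducible p := by
    refine (Polynomial.irreducible_iff_roots_eq_zero_of_degree_le_three (by omega) (by omega)).2 ?_
    refine Multiset.eq_zero_of_forall_notMem fun x hx => hD x ?_
    have h0 := (Polynomial.mem_roots'.1 hx).2
    simp [hp] at h0
    grind
  have : Fact (Irreducible p) := ⟨hirr⟩
  have hfr : Module.finrank F (AdjoinRoot p) = 2 := by
    rw [(AdjoinRoot.powerBasis hirr.ne_zero).finrank, AdjoinRoot.powerBasis_dim, hdeg]
  obtain ⟨f⟩ := FiniteField.nonempty_algHom_of_finrank_dvd (F := F) (K := AdjoinRoot p) (L := K)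
    (by rw [hfr, h2])
  have hr : f (AdjoinRoot.root p) ^ 2 = f (AdjoinRoot.root p) + algebraMap F K D := by
    have h0 : Polynomial.aeval (f (AdjoinRoot.root p)) p = 0 := by
      rw [Polynomial.aeval_algHom_apply, AdjoinRoot.aeval_eq, AdjoinRoot.mk_self, map_zero]
    simp [hp] at h0
    grind
  refine ⟨_, ?_, hr⟩
  rintro ⟨x, hx⟩
  rw [← hx] at hr
  refine hD x ((algebraMap F K).injective ?_)
  simp only [map_add, map_pow]
  grind

/-- σ would permute the two roots x, x + 1, and neither σ(x) = x nor σ(x) = x + 1 is possible. In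
other words, F contains no field of order four. -/
theorem sq_add_self_ne_one [CharP F 2] {σ : F ≃+* F} (hσ : ∀ x, σ (σ x) = x ^ 2) (x : F) :
    x ^ 2 + x ≠ 1 := fun h => by
  have h1 : σ (x ^ 2 + x) = 1 := by rw [h, map_one]
  rw [map_add, map_pow] at h1
  have h2 : (σ x + x) * (σ x + x + 1) = 0 := by grind
  rcases mul_eq_zero.1 h2 with h3 | h3
  · rcases eq_zero_or_one_of_sigma_eq hσ (x := x) (by grind) with rfl | rfl <;> simp at h
  · exact sigma_ne_add_one hσ x (by grind)

variable {σ : F ≃+* F}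

theorem affPt_notMem_stdUnital {ε : K} (hε : ε ∉ Set.range (algebraMap F K)) :
    affPt 1 0 ∉ stdUnital σ ε := by
  rintro (h | ⟨s, t, r, h⟩)
  · exact affPt_ne_vertPt _ _ h
  · obtain ⟨h1, h2⟩ := affPt_injective h
    obtain ⟨rfl, rfl⟩ := rep_unique hε (a := 1) (b := 0) (by simpa using h1)
    have := (rep_eq_zero hε h2.symm).2
    simp [titsForm] at this

variable [CharP F 2]

theorem exists_coneProj_of_unital (h2 : Module.finrank F K = 2) (hσ : ∀ x, σ (σ x) = x ^ 2)
    {ε : K} (hε : ε ∉ Set.range (algebraMap F K)) {e : ℕ} (he : ∀ x, σ x = x ^ 2 ^ (e + 1))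
    {C : Set (ℙ F (F × (K × K)))} (hC : IsTitsCone e C) {w : K × K} (hw : w ≠ 0)
    (hCw : C ∩ subspacePoints (hyperplaneAtInfinity F K) = subspacePoints (spreadElement F w)) :
    ∃ Ψ : F × (K × K) →ₗ[F] (Fin 4 → F), IsConeProj Ψ w ∧
      ∀ v hv, Projectivization.mk F v hv ∈ C ↔ IsTitsVec σ (Ψ v) := by
  have : FiniteDimensional F K := Module.finite_of_finrank_pos (by omega)
  obtain ⟨Ψ, n, hn, hsurj, hker, hΨ⟩ := exists_projection_of_isTitsCone (by simp [h2]) he hC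
  obtain ⟨Ψ', hΨ', hT⟩ := exists_isConeProj h2 hσ hε hsurj hker hn hw fun v => by
    by_cases hv : v = 0
    · subst hv
      refine ⟨fun _ => ⟨0, by rw [zero_smul]; rfl⟩, fun _ => ⟨rfl, .inr ⟨0, by simp⟩⟩⟩
    · rw [← hΨ v hv, ← mem_spreadElement, ← mk_mem_subspacePoints hv, ← hCw, Set.mem_inter_iff,
        mk_mem_subspacePoints, and_comm]
      rfl
  exact ⟨Ψ', hΨ', fun v hv => (hΨ v hv).trans (hT v).symm⟩

theorem mk_mem_lineXZero {v : Fin 3 → K} (hv : v ≠ 0) :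
    Projectivization.mk K v hv ∈ subspacePoints (lineXZero K) ↔ v 0 = 0 := by
  rw [mk_mem_subspacePoints]; rfl

/-- For the upper bound the point is prescribed and the slope ε' is whatever results; ε serves only
as a basis element of K over F. -/
theorem exists_std_of_point (h2 : Module.finrank F K = 2) (hσ : ∀ x, σ (σ x) = x ^ 2)
    {ε : K} (hε : ε ∉ Set.range (algebraMap F K)) {e : ℕ} (he : ∀ x, σ x = x ^ 2 ^ (e + 1))
    {linf U : Set (ℙ K (Fin 3 → K))} (hU : IsBuekenhoutTitsUnital F e linf U)
    {P : ℙ K (Fin 3 → K)} (hP : P ∉ linf ∪ U) :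
    ∃ (ε' : K) (g : (Fin 3 → K) ≃ₗ[K] (Fin 3 → K)), ε' ∉ Set.range (algebraMap F K) ∧
      U = Projectivization.map g.toLinearMap g.injective '' stdUnital σ ε' ∧
      P = Projectivization.map g.toLinearMap g.injective (affPt 1 0) := by
  obtain ⟨g, C, hC, ⟨w, hw, hCw⟩, rfl, rfl⟩ := hU
  obtain ⟨Ψ, hΨ, hΨC⟩ := exists_coneProj_of_unital h2 hσ hε he hC hw hCw
  obtain ⟨P, rfl⟩ : ∃ P', Projectivization.map g.toLinearMap g.injective P' = P :=
    ⟨_, map_equiv_map_symm g P⟩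
  rw [Set.mem_union, not_or, (map_equiv_injective g).mem_set_image,
    (map_equiv_injective g).mem_set_image] at hP
  obtain ⟨k, rfl⟩ : ∃ k : K × K, P = affPt k.1 k.2 := by
    induction P using Projectivization.ind with
    | h v hv =>
    have h0 : v 0 ≠ 0 := fun h => hP.1 ((mk_mem_lineXZero hv).2 h)
    refine ⟨(v 1 / v 0, v 2 / v 0), (Projectivization.mk_eq_mk_iff' K _ _ _ _).2 ⟨v 0, ?_⟩⟩
    ext i; fin_cases i <;> simp <;> field_simp
  have hk : ¬ IsTitsVec σ (Ψ (1, k)) := fun hk =>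
    hP.2 ⟨_, (hΨC _ (one_pair_ne_zero k)).2 hk, abbPoint_affine k⟩
  obtain ⟨h, hh, hhΨ, hhk⟩ := hΨ.exists_isTitsAut_point hσ hk
  obtain ⟨ε', a, hε', h1, h2', h3, h4⟩ := hhΨ.exists_slope
  obtain ⟨g1, -, himg, hpt⟩ := hhΨ.exists_coords h2 hε' h1 h2' h3 h4 hhk
    (C := C) fun v hv => (hΨC v hv).trans (hh.2 _).symm
  refine ⟨ε', g1.trans g, hε', ?_, ?_⟩
  · rw [map_trans_image, himg]
  · rw [← hpt]; rfl

/-- For the existence statements the slope is prescribed and the point is any affine one over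
(1,1,0,0). -/
theorem exists_std_of_slope (h2 : Module.finrank F K = 2) (hσ : ∀ x, σ (σ x) = x ^ 2)
    {ε : K} (hε : ε ∉ Set.range (algebraMap F K)) {e : ℕ} (he : ∀ x, σ x = x ^ 2 ^ (e + 1))
    {linf U : Set (ℙ K (Fin 3 → K))} (hU : IsBuekenhoutTitsUnital F e linf U) :
    ∃ g : (Fin 3 → K) ≃ₗ[K] (Fin 3 → K),
      U = Projectivization.map g.toLinearMap g.injective '' stdUnital σ ε ∧
      Projectivization.map g.toLinearMap g.injective (affPt 1 0) ∉ linf ∪ U := by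
  obtain ⟨g, C, hC, ⟨w, hw, hCw⟩, rfl, rfl⟩ := hU
  obtain ⟨Ψ, hΨ, hΨC⟩ := exists_coneProj_of_unital h2 hσ hε he hC hw hCw
  obtain ⟨h, hh, hhΨ, a, h1, h2', h3, h4⟩ := hΨ.exists_isTitsAut_slope hσ hε
  obtain ⟨⟨x, k⟩, hk⟩ := hhΨ.surj ![1, 1, 0, 0]
  obtain rfl : x = 1 := by
    have := hhΨ.apply_zero (x, k)
    rw [hk] at this
    exact this.symm
  obtain ⟨g1, hg1, himg, hpt⟩ := hhΨ.exists_coords h2 hε h1 h2' h3 h4 hk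
    (C := C) fun v hv => (hΨC v hv).trans (hh.2 _).symm
  have himg' : Projectivization.map g.toLinearMap g.injective '' (abbPoint F K '' C) =
      Projectivization.map (g1.trans g).toLinearMap (g1.trans g).injective '' stdUnital σ ε := by
    rw [map_trans_image, himg]
  refine ⟨g1.trans g, himg', ?_⟩
  rw [Set.mem_union, not_or]
  constructor
  · have : Projectivization.map (g1.trans g).toLinearMap (g1.trans g).injective (affPt 1 0) =
      Projectivization.map g.toLinearMap g.injective (affPt k.1 k.2) := by rw [← hpt]; rfl
    rw [this, (map_equiv_injective g).mem_set_image, affPt, mk_mem_lineXZero]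
    simp
  · rw [himg', (map_equiv_injective _).mem_set_image]
    exact affPt_notMem_stdUnital hε

theorem exists_point_line_ncard (h2 : Module.finrank F K = 2) (hσ : ∀ x, σ (σ x) = x ^ 2)
    {ε : K} (hε : ε ∉ Set.range (algebraMap F K)) {T D : F}
    (hTD : ε ^ 2 = algebraMap F K T * ε + algebraMap F K D)
    {e : ℕ} (he : ∀ x, σ x = x ^ 2 ^ (e + 1))
    {linf U : Set (ℙ K (Fin 3 → K))} (hU : IsBuekenhoutTitsUnital F e linf U)
    {c : Fin 3 → K} (hc : c ≠ 0) {k : ℕ} (hk : (footParams σ ε T c).ncard = k) :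
    ∃ P : ℙ K (Fin 3 → K), P ∉ linf ∪ U ∧ ∃ l : Set (ℙ K (Fin 3 → K)), IsLine l ∧
      (l ∩ feet U P).ncard = k := by
  obtain ⟨g, hg, hP⟩ := exists_std_of_slope h2 hσ hε he hU
  refine ⟨_, hP, _, isLine_image g (isLine_iff.2 ⟨c, hc, rfl⟩), ?_⟩
  rw [hg, ncard_image_inter_feet, ncard_line_inter_feet h2 hσ hε hTD, hk]

theorem ncard_line_inter_feet_le [Finite F] (h2 : Module.finrank F K = 2)
    (hσ : ∀ x, σ (σ x) = x ^ 2)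
    {ε : K} (hε : ε ∉ Set.range (algebraMap F K)) {e : ℕ} (he : ∀ x, σ x = x ^ 2 ^ (e + 1))
    {linf U : Set (ℙ K (Fin 3 → K))} (hU : IsBuekenhoutTitsUnital F e linf U)
    {P : ℙ K (Fin 3 → K)} (hP : P ∉ linf ∪ U) {l : Set (ℙ K (Fin 3 → K))} (hl : IsLine l) :
    (l ∩ feet U P).ncard ≤ 4 := by
  obtain ⟨ε', g, hε', rfl, rfl⟩ := exists_std_of_point h2 hσ hε he hU hP
  obtain ⟨l, hl', rfl⟩ := exists_eq_image_of_isLine g hl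
  obtain ⟨c, hc, rfl⟩ := isLine_iff.1 hl'
  obtain ⟨D, T, hTD⟩ := exists_rep h2 hε' (ε' ^ 2)
  rw [add_comm] at hTD
  rw [ncard_image_inter_feet, ncard_line_inter_feet h2 hσ hε' hTD]
  exact ncard_footParams_le_four h2 hσ hε' hTD hc

theorem exists_point_line_ncard_eq [Finite F] [Finite K] (h2 : Module.finrank F K = 2)
    (hσ : ∀ x, σ (σ x) = x ^ 2) (hcard : 2 < Nat.card F)
    {e : ℕ} (he : ∀ x, σ x = x ^ 2 ^ (e + 1))
    {linf U : Set (ℙ K (Fin 3 → K))} (hU : IsBuekenhoutTitsUnital F e linf U)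
    {k : ℕ} (hk : k ≤ 4) :
    ∃ P : ℙ K (Fin 3 → K), P ∉ linf ∪ U ∧ ∃ l : Set (ℙ K (Fin 3 → K)), IsLine l ∧
      (l ∩ feet U P).ncard = k := by
  obtain ⟨b, hb⟩ : ∃ b : F, b ∉ ({0, 1} : Set F) := by
    by_contra! hall
    have : (Set.univ : Set F) ⊆ {0, 1} := fun x _ => hall x
    have := (Set.ncard_le_ncard this).trans (Set.ncard_insert_le 0 {1})
    rw [Set.ncard_univ, Set.ncard_singleton] at this
    omega
  rw [Set.mem_insert_iff, Set.mem_singleton_iff, not_or] at hb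
  obtain ⟨ω, hω, hω2⟩ := exists_quadratic_root (K := K) h2 (sq_add_self_ne_one hσ)
  rw [map_one] at hω2
  have hω' : ω ^ 2 = algebraMap F K 1 * ω + algebraMap F K 1 := by simpa using hω2
  interval_cases k
  · exact exists_point_line_ncard h2 hσ hω hω' he hU (fun h => by simpa using congrFun h 0)
      ncard_footParams_zero
  · exact exists_point_line_ncard h2 hσ hω hω' he hU (fun h => by simpa using congrFun h 1)
      (ncard_footParams_one hω)
  · obtain ⟨c, hc, hc2⟩ := exists_ncard_footParams_two h2 hσ hω hω2 hb.1 hb.2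
    exact exists_point_line_ncard h2 hσ hω hω' he hU hc hc2
  · exact exists_point_line_ncard h2 hσ hω hω' he hU (fun h => by simpa using congrFun h 1)
      (ncard_footParams_three hσ hω hω2)
  · obtain ⟨D, a, x, hD, h⟩ := exists_ellipse_four hσ hb.1 hb.2
    obtain ⟨ε, hε, hε2⟩ := exists_quadratic_root (K := K) h2 hD
    exact exists_point_line_ncard h2 hσ hε (by simpa using hε2) he hU
      (fun h => by simpa using congrFun h 1) (ncard_footParams_four h2 hσ hε hε2 hb.1 hb.2 h)

theorem exists_sigma [Finite F] {e : ℕ} (hF : Nat.card F = 2 ^ (2 * e + 1)) :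
    ∃ σ : F ≃+* F, (∀ x, σ x = x ^ 2 ^ (e + 1)) ∧ ∀ x, σ (σ x) = x ^ 2 := by
  refine ⟨iterateFrobeniusEquiv F 2 (e + 1), fun x => iterateFrobeniusEquiv_def F 2 (e + 1) x,
    fun x => ?_⟩
  have := Fintype.ofFinite F
  rw [iterateFrobeniusEquiv_def, iterateFrobeniusEquiv_def, ← pow_mul, ← pow_add]
  -- σ² is the power 2q, and x ↦ x^q is the identity on F.
  have h : 2 ^ (e + 1 + (e + 1)) = Fintype.card F * 2 := by
    rw [Fintype.card_eq_nat_card, hF]; ring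
  rw [h, pow_mul, FiniteField.pow_card]

end Unital

end BTUnital

theorem mainTheorem3 {F K : Type*} [Field F] [Field K] [Algebra F K]
    (e : ℕ) (he : 1 ≤ e) (hF : Nat.card F = 2 ^ (2 * e + 1)) (hK : Nat.card K = Nat.card F ^ 2)
    (linf U : Set (ℙ K (Fin 3 → K))) (hU : BTUnital.IsBuekenhoutTitsUnital F e linf U) :
    (∀ P : ℙ K (Fin 3 → K), P ∉ linf ∪ U → ∀ l : Set (ℙ K (Fin 3 → K)), BTUnital.IsLine l →
      (l ∩ BTUnital.feet U P).ncard ≤ 4) ∧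
    (∀ k : ℕ, k ≤ 4 → ∃ P : ℙ K (Fin 3 → K), P ∉ linf ∪ U ∧
      ∃ l : Set (ℙ K (Fin 3 → K)), BTUnital.IsLine l ∧ (l ∩ BTUnital.feet U P).ncard = k) ∧
    ¬ (∀ P : ℙ K (Fin 3 → K), P ∉ linf ∪ U → ∀ l : Set (ℙ K (Fin 3 → K)), BTUnital.IsLine l →
      (l ∩ BTUnital.feet U P).ncard ∈ ({0, 1, 2, 4} : Set ℕ)) := by
  have hFfin : Finite F := Nat.finite_of_card_ne_zero (by rw [hF]; positivity)
  have hKfin : Finite K := Nat.finite_of_card_ne_zero (by rw [hK, hF]; positivity)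
  have hcard : 2 < Nat.card F := by
    rw [hF]
    calc 2 < 2 ^ 2 := by norm_num
      _ ≤ 2 ^ (2 * e + 1) := Nat.pow_le_pow_right (by norm_num) (by omega)
  have hchar : CharP F 2 := by
    have := Fintype.ofFinite F
    exact charP_of_card_eq_prime_pow (p := 2) (f := 2 * e + 1) (by rw [Fintype.card_eq_nat_card, hF])
  have h2 : Module.finrank F K = 2 := by
    have h := Module.natCard_eq_pow_finrank (K := F) (V := K)
    rw [hK] at h
    exact (Nat.pow_right_injective hcard.le h).symm
  obtain ⟨σ, he', hσ⟩ := BTUnital.exists_sigma hF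
  obtain ⟨ω, hω, -⟩ := BTUnital.exists_quadratic_root (K := K) h2 (BTUnital.sq_add_self_ne_one hσ)
  refine ⟨fun P hP l hl => BTUnital.ncard_line_inter_feet_le h2 hσ hω he' hU hP hl,
    fun k hk => BTUnital.exists_point_line_ncard_eq h2 hσ hcard he' hU hk, fun hall => ?_⟩
  obtain ⟨P, hP, l, hl, h3⟩ :=
    BTUnital.exists_point_line_ncard_eq h2 hσ hcard he' hU (k := 3) (by norm_num)
  have := hall P hP l hl
  rw [h3] at this
  simp at this
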